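/- Let $A,B\in\mathbb C^{n\times n}$ be Hermitian such that the pencil $A-\lambda B$ is positive semi-definite, i.e. $A-\lambda_0B\succeq 0$ for some $\lambda_0\in\mathbb R$, and such that $B$ is genuinely indefinite, i.e. $B$ has both positive and negative eigenvalues. Let $n_+$ and $n_-$ be the numbers of positive and of negative eigenvalues of $B$, counted with multiplicity. A number $\mu\in\mathbb C$ is a finite eigenvalue of $A-\lambda B$ if $\operatorname{rank}(A-\mu B)<\rho:=\max_{\lambda\in\mathbb C}\operatorname{rank}(A-\lambda B)$; its (algebraic) multiplicity is its multiplicity as a root of the greatest common divisor of the $\rho\times\rho$ minors of the polynomial matrix $A-\lambda B$. Then $A-\lambda B$ has exactly $n_++n_-$ finite eigenvalues, counted with multiplicity, and all of them are real; denote them by $$\lambda_{n_-}^-\le\cdots\le\lambda_1^-\le\lambda_1^+\le\cdots\le\lambda_{n_+}^+ .$$ Let $0\le k_\pm\le n_\pm$, $k=k_++k_-$, let $D_\pm\in\mathbb C^{k_\pm\times k_\pm}$ be Hermitian with $D_\pm\succeq 0$ and eigenvalues $\omega_1^\pm\ge\cdots\ge\omega_{k_\pm}^\pm$, and put $D=\operatorname{diag}(D_+,D_-)$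 and $J_k=\operatorname{diag}(I_{k_+},-I_{k_-})$. Then $$\inf_{X\in\mathbb C^{n\times k},\;X^{\mathsf H}BX=J_k}\operatorname{tr}(DX^{\mathsf H}AX)=\sum_{i=1}^{k_+}\omega_i^+\lambda_i^+-\sum_{i=1}^{k_-}\omega_i^-\lambda_i^- ,$$ where the infimum is over a non-empty set of real numbers. The infimum is attained if $A-\lambda B$ is diagonalizable, i.e. if there is a nonsingular $U\in\mathbb C^{n\times n}$ for which $U^{\mathsf H}AU$ and $U^{\mathsf H}BU$ are both diagonal. -/

import Mathlib

open scoped Polynomial ComplexOrder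

namespace MatrixPencil

noncomputable section

/-- The number of positive eigenvalues of a Hermitian matrix, counted with multiplicity. -/
def numPosEig {n : ℕ} {B : Matrix (Fin n) (Fin n) ℂ} (hB : B.IsHermitian) : ℕ :=
  (Finset.univ.filter fun i => 0 < hB.eigenvalues i).card

/-- The number of negative eigenvalues of a Hermitian matrix, counted with multiplicity. -/
def numNegEig {n : ℕ} {B : Matrix (Fin n) (Fin n) ℂ} (hB : B.IsHermitian) : ℕ :=
  (Finset.univ.filter fun i => hB.eigenvalues i < 0).card

/-- A Hermitian matrix is genuinely indefinite if it has both positive and negative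
eigenvalues. -/
def GenuinelyIndefinite {n : ℕ} {B : Matrix (Fin n) (Fin n) ℂ} (hB : B.IsHermitian) : Prop :=
  (∃ i, 0 < hB.eigenvalues i) ∧ ∃ i, hB.eigenvalues i < 0

/-- The eigenvalues of a Hermitian matrix with multiplicity, in decreasing order. -/
def decreasingEig {k : ℕ} {D : Matrix (Fin k) (Fin k) ℂ} (hD : D.IsHermitian) (i : Fin k) : ℝ :=
  hD.eigenvalues₀ (Fin.cast (Fintype.card_fin k).symm i)

/-- The pencil `A - λ B` of Hermitian matrices is positive semi-definite: there is a real `λ₀`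
with `A - λ₀ B ⪰ 0`. -/
def IsPosSemidefPencil {n : ℕ} (A B : Matrix (Fin n) (Fin n) ℂ) : Prop :=
  A.IsHermitian ∧ B.IsHermitian ∧ ∃ l₀ : ℝ, (A - (l₀ : ℂ) • B).PosSemidef

/-- The normal rank `max_λ rank (A - λ B)`, a maximum of natural numbers bounded by `n`. -/
def normalRank {n : ℕ} (A B : Matrix (Fin n) (Fin n) ℂ) : ℕ :=
  ⨆ l : ℂ, (A - l • B).rank

/-- `μ` is a finite eigenvalue of `A - λ B` if the rank drops at `μ`. The pencil may be singular,
i.e. `det (A - λ B)` may vanish identically. -/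
def IsFiniteEigenvalue {n : ℕ} (A B : Matrix (Fin n) (Fin n) ℂ) (μ : ℂ) : Prop :=
  (A - μ • B).rank < normalRank A B

/-- The minor of the polynomial matrix `A - X B` with rows `f` and columns `g`. -/
def pencilMinor {n r : ℕ} (A B : Matrix (Fin n) (Fin n) ℂ) (f g : Fin r → Fin n) : ℂ[X] :=
  ((A.map Polynomial.C - (Polynomial.X : ℂ[X]) • B.map Polynomial.C).submatrix f g).det

/-- The algebraic multiplicity of `μ` as a finite eigenvalue of the (possibly singular) pencil
`A - λ B`: the multiplicity of `μ` as a root of the greatest common divisor of the minors of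
`A - λ B` whose order is the normal rank (equivalently, the sum of the degrees of the elementary
divisors at `μ`), i.e. the least root multiplicity at `μ` of such a minor that is not the zero
polynomial. For a regular pencil it is the multiplicity of `μ` as a root of `det (A - λ B)`. -/
def algMultiplicity {n : ℕ} (A B : Matrix (Fin n) (Fin n) ℂ) (μ : ℂ) : ℕ :=
  sInf {m : ℕ | ∃ f g : Fin (normalRank A B) → Fin n,
    pencilMinor A B f g ≠ 0 ∧ (pencilMinor A B f g).rootMultiplicity μ = m}

open Matrix in
/-- A matrix of rank `r` has a nonzero minor of order `r`. -/
theorem exists_submatrix_det_ne_zero {n r : ℕ} (M : Matrix (Fin n) (Fin n) ℂ) (h : M.rank = r) :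
   ∃ f g : Fin r → Fin n, (M.submatrix f g).det ≠ 0 := by
  have key : ∀ {a b : ℕ} (N : Matrix (Fin a) (Fin b) ℂ) (_ : N.rank = r), ∃ f : Fin r → Fin a,
      (N.submatrix f id).rank = r := by
    intro a b N hN
    subst hN
    have h2 := Submodule.exists_fun_fin_finrank_span_eq ℂ (Set.range N.row)
    rw [← Set.finrank, Set.finrank, ← N.rank_eq_finrank_span_row] at h2
    obtain ⟨f, hf, -, hl⟩ := h2
    choose g hg using hf
    refine ⟨g, ?_⟩
    have : (N.submatrix g id).row = f := by
      funext i; rw [← hg i]; rfl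
    rw [LinearIndependent.rank_matrix (by rw [this]; exact hl)]
    simp
  obtain ⟨f, hf⟩ := key M h
  obtain ⟨g, hg⟩ := key (M.submatrix f id)ᵀ (by rw [rank_transpose, hf])
  refine ⟨f, g, ?_⟩
  intro h0
  have h1 : ((M.submatrix f id)ᵀ.submatrix g id) = (M.submatrix f g)ᵀ := rfl
  rw [h1, rank_transpose] at hg
  have h3 : LinearIndependent ℂ (M.submatrix f g).row := by
    rw [linearIndependent_iff_card_eq_finrank_span, Set.finrank, ← rank_eq_finrank_span_row, hg]
    simp
  have := (Matrix.linearIndependent_rows_iff_isUnit.1 h3)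
  rw [Matrix.isUnit_iff_isUnit_det, h0] at this
  simp at this

open Matrix in
theorem eval_pencilMinor {n r : ℕ} (A B : Matrix (Fin n) (Fin n) ℂ) (f g : Fin r → Fin n) (μ : ℂ) :
    (pencilMinor A B f g).eval μ = ((A - μ • B).submatrix f g).det := by
  rw [pencilMinor, ← Polynomial.coe_evalRingHom, RingHom.map_det]
  congr 1
  ext i j
  simp
  ring

open Matrix in
/-- The algebraic multiplicity is positive exactly at the finite eigenvalues. -/
theorem algMultiplicity_pos_iff {n : ℕ} (A B : Matrix (Fin n) (Fin n) ℂ) (μ : ℂ) :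
    0 < algMultiplicity A B μ ↔ IsFiniteEigenvalue A B μ := by
  have bdd : BddAbove (Set.range fun l : ℂ => (A - l • B).rank) :=
    ⟨n, by rintro _ ⟨l, rfl⟩; exact rank_le_height _⟩
  obtain ⟨l₀, hl₀⟩ : ∃ l : ℂ, (A - l • B).rank = normalRank A B :=
    Nat.sSup_mem (Set.range_nonempty _) bdd
  obtain ⟨f₀, g₀, h₀⟩ := exists_submatrix_det_ne_zero _ hl₀
  have ne : {m : ℕ | ∃ f g : Fin (normalRank A B) → Fin n,
    pencilMinor A B f g ≠ 0 ∧ (pencilMinor A B f g).rootMultiplicity μ = m}.Nonempty := by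
    refine ⟨_, f₀, g₀, ?_, rfl⟩
    intro h; rw [← eval_pencilMinor, h] at h₀; simp at h₀
  constructor
  · intro h
    refine lt_of_le_of_ne (le_ciSup bdd μ) fun he => ?_
    obtain ⟨f, g, hfg⟩ := exists_submatrix_det_ne_zero _ he
    rw [← eval_pencilMinor] at hfg
    have : algMultiplicity A B μ ≤ 0 :=
      Nat.sInf_le ⟨f, g, fun h => by simp [h] at hfg, Polynomial.rootMultiplicity_eq_zero hfg⟩
    omega
  · intro h
    obtain ⟨f, g, hne, hm⟩ := Nat.sInf_mem ne
    rw [algMultiplicity, ← hm, Polynomial.rootMultiplicity_pos hne, Polynomial.IsRoot,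
      eval_pencilMinor]
    by_contra hd
    have h1 := rank_submatrix_le (A - μ • B) f g
    rw [rank_of_isUnit _ ((Matrix.isUnit_iff_isUnit_det _).2 (isUnit_iff_ne_zero.2 hd))] at h1
    simp at h1
    unfold IsFiniteEigenvalue at h
    omega

/-- The real numbers `lp 0 ≤ lp 1 ≤ ⋯` and `lm 0 ≥ lm 1 ≥ ⋯`, all of the latter being at most all
of the former, list all finite eigenvalues (in `ℂ`) of `A - λ B`, each as often as its algebraic
multiplicity says. Such a list is unique, given `p` and `q`. -/
structure IsOrderedFiniteEig {n p q : ℕ} (A B : Matrix (Fin n) (Fin n) ℂ)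
    (lp : Fin p → ℝ) (lm : Fin q → ℝ) : Prop where
  monotone_pos : Monotone lp
  antitone_neg : Antitone lm
  neg_le_pos : ∀ i j, lm i ≤ lp j
  count_eq : ∀ μ : ℂ, Nat.card {i : Fin p // (lp i : ℂ) = μ} +
    Nat.card {i : Fin q // (lm i : ℂ) = μ} = algMultiplicity A B μ

/-- A Hermitian pencil `A - λ B` is diagonalizable if a single nonsingular congruence makes both
`A` and `B` diagonal. -/
def IsDiagonalizablePencil {n : ℕ} (A B : Matrix (Fin n) (Fin n) ℂ) : Prop :=
  ∃ U : Matrix (Fin n) (Fin n) ℂ, IsUnit U.det ∧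
    (U.conjTranspose * A * U).IsDiag ∧ (U.conjTranspose * B * U).IsDiag

/-- `J = diag(I, -I)` with blocks of orders `p` and `q`. -/
def signMatrix (p q : ℕ) : Matrix (Fin p ⊕ Fin q) (Fin p ⊕ Fin q) ℂ :=
  Matrix.fromBlocks 1 0 0 (-1)

/-- The values `tr (D Xᴴ A X)` of the objective function, `D = diag(Dp, Dm)`, over all `X` with
`Xᴴ B X = diag(I, -I)`. For Hermitian `A`, `Dp`, `Dm` the trace is real. -/
def traceValues {n p q : ℕ} (A B : Matrix (Fin n) (Fin n) ℂ) (Dp : Matrix (Fin p) (Fin p) ℂ)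
    (Dm : Matrix (Fin q) (Fin q) ℂ) : Set ℝ :=
  {t : ℝ | ∃ X : Matrix (Fin n) (Fin p ⊕ Fin q) ℂ,
    X.conjTranspose * B * X = signMatrix p q ∧
    (Matrix.fromBlocks Dp 0 0 Dm * (X.conjTranspose * A * X)).trace = (t : ℂ)}

end

end MatrixPencil

/-!
Let `C = A - λ₀ B ⪰ 0`. On the matrices `X` with `Xᴴ B X = J` the objective for `A` differs from
that for `C` by the constant `λ₀ tr (D J)`, and the eigenvalues of `A - λ B` are those of `C - λ B`
shifted by `λ₀`. After a unitary change of the columns of `X` the weights `D` are diagonal and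
decreasing. So let `A = C ⪰ 0` and `D = diag(ω)`.

*Diagonal pencils.* Let `B = diag(b)`, `C = diag(c)` with `c ≥ 0`. The columns of `X` belonging to
`+1` and those belonging to `-1` are treated separately. For the former, dropping the rows with
`b ≤ 0` and scaling the others by `√b` leaves a matrix `Y` with `Yᴴ Y ⪰ 1`, and a rotation and
shrinking of its columns makes them orthonormal; then the squared row norms are at most `1` and the
sum of the smallest ratios `c / b` bounds the trace from below (`sum_castLE_le_sum_norm_sq`).
Summation by parts brings in the weights, and scaled unit vectors attain the bound
(`isLeast_traceValues_diagonal`). By congruence this covers every diagonalizable pencil, and every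
pencil with `C ≻ 0`, for which moreover `det (C - μ B) = κ ∏ (γ⁺ - μ) ∏ (γ⁻ + μ)` with the lists
`γ⁺`, `γ⁻` of ratios (`exists_isLeast_traceValues_of_posDef`).

*Regular semidefinite pencils.* No canonical form is needed: replace `C` by `C + ε`. The lists for
`C + ε` are bounded, since their total is a trace minimum and so increases with `ε`; let `γ⁺`, `γ⁻`
be a limit point as `ε → 0`. The infimum for `C` is the limit of the minima for `C + ε`. The
constant `κ` is eliminated by evaluating at `μ = i`, where neither `det (C - i B)` nor the product
over the real limits vanishes, so that the factorization of the determinant passes to the limit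
(`exists_isGLB_traceValues_of_posSemidef`).

*Singular pencils.* `C - i B` is singular only on `ker C ∩ ker B`. Compressing to the orthogonal
complement gives a regular pencil `C' - λ B'` with `C = W C' Wᴴ`, `B = W B' Wᴴ`. The trace values
and the inertia are unchanged, and the minors of maximal order of `C - X B` are constant multiples of
`det (C' - X B')`, which identifies the algebraic multiplicities
(`algMultiplicity_of_compression`).
-/

namespace MatrixPencil

noncomputable section

open Matrix

/-! ### Inequalities for ordered sequences -/

/-- Summation by parts. For `w = 0` it says that a sum with non-negative partial sums stays
non-negative under non-negative decreasing weights; general `w` is needed for the induction. -/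
theorem mul_sum_le_sum_mul_of_partialSums_nonneg {k : ℕ} (ω d : Fin k → ℝ) (hω : Antitone ω)
    (hd : ∀ m (hm : m ≤ k), 0 ≤ ∑ i : Fin m, d (Fin.castLE hm i)) (w : ℝ) (hw : ∀ i, w ≤ ω i) :
    w * ∑ i, d i ≤ ∑ i, ω i * d i := by
  induction k generalizing w with
  | zero => simp
  | succ k ih =>
    have h := ih (fun i => ω i.castSucc) (fun i => d i.castSucc)
      (fun i j hij => hω (Fin.castSucc_le_castSucc_iff.2 hij))
      (fun m hm => hd m (hm.trans k.le_succ)) (ω (Fin.last k)) (fun i => hω (Fin.le_last _))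
    have h1 := hd (k + 1) le_rfl
    have h2 := hw (Fin.last k)
    simp only [Fin.castLE_rfl, id] at h1
    rw [Fin.sum_univ_castSucc (fun i => ω i * d i)]
    calc w * ∑ i, d i ≤ ω (Fin.last k) * ∑ i, d i := mul_le_mul_of_nonneg_right h2 h1
      _ = ω (Fin.last k) * ∑ i : Fin k, d i.castSucc + ω (Fin.last k) * d (Fin.last k) := by
        rw [Fin.sum_univ_castSucc, mul_add]
      _ ≤ _ := by linarith

theorem sum_castLE_eq_sum_ite {p k : ℕ} (hk : k ≤ p) (f : Fin p → ℝ) :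
    ∑ i : Fin k, f (Fin.castLE hk i) = ∑ l : Fin p, if (l : ℕ) < k then f l else 0 := by
  rw [← Finset.sum_filter]
  refine Finset.sum_bij (fun i _ => Fin.castLE hk i) (by simp) (by simp) ?_ (by simp)
  intro l hl
  exact ⟨⟨l, by simpa using hl⟩, by simp, rfl⟩

/-- Among weights `0 ≤ h ≤ 1` of total mass `k`, the indicator of the first `k` indices
minimises the weighted sum of an increasing sequence. -/
theorem sum_castLE_le_sum_mul {p k : ℕ} (hk : k ≤ p) (γ h : Fin p → ℝ) (hγ : Monotone γ)
    (h0 : ∀ l, 0 ≤ h l) (h1 : ∀ l, h l ≤ 1) (hs : ∑ l, h l = k) :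
    ∑ i : Fin k, γ (Fin.castLE hk i) ≤ ∑ l, γ l * h l := by
  rcases Nat.eq_zero_or_pos k with rfl | hpos
  · have : ∀ l, h l = 0 := by
      simpa [Finset.sum_eq_zero_iff_of_nonneg (fun i _ => h0 i)] using hs
    simp [this]
  · -- compare with the threshold value `τ`: `(γ - τ) (h - 1_{l < k}) ≥ 0` in every index
    set τ : ℝ := γ ⟨k - 1, by omega⟩
    have e1 : ∑ l : Fin p, (if (l : ℕ) < k then (1 : ℝ) else 0) = k := by
      rw [← sum_castLE_eq_sum_ite hk (fun _ => 1)]; simp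
    have key : ∀ l : Fin p, 0 ≤ (γ l - τ) * (h l - if (l : ℕ) < k then 1 else 0) := by
      intro l
      split_ifs with hl
      · exact mul_nonneg_of_nonpos_of_nonpos
          (sub_nonpos.2 (hγ (Fin.le_def.2 (by simp; omega)))) (sub_nonpos.2 (h1 l))
      · rw [sub_zero]
        exact mul_nonneg (sub_nonneg.2 (hγ (Fin.le_def.2 (by simp; omega)))) (h0 l)
    have := Finset.sum_nonneg (fun l (_ : l ∈ Finset.univ) => key l)
    have e2 : ∀ l : Fin p, (γ l - τ) * (h l - if (l : ℕ) < k then 1 else 0) =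
        γ l * h l - (if (l : ℕ) < k then γ l else 0) -
          (τ * h l - τ * (if (l : ℕ) < k then 1 else 0)) := by
      intro l; split_ifs <;> ring
    simp only [e2, Finset.sum_sub_distrib, ← Finset.mul_sum, hs, e1] at this
    rw [sum_castLE_eq_sum_ite]
    linarith

/-! ### Hermitian matrices -/

theorem exists_unitary_diagonal {m : Type*} [Fintype m] [DecidableEq m] {A : Matrix m m ℂ}
    (hA : A.IsHermitian) : ∃ V : Matrix m m ℂ, Vᴴ * V = 1 ∧ V * Vᴴ = 1 ∧
      Vᴴ * A * V = diagonal fun i => (hA.eigenvalues i : ℂ) := by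
  have h1 : (hA.eigenvectorUnitary : Matrix m m ℂ)ᴴ * hA.eigenvectorUnitary = 1 :=
    Unitary.coe_star_mul_self _
  refine ⟨hA.eigenvectorUnitary, h1, mul_eq_one_comm.1 h1, ?_⟩
  have := hA.conjStarAlgAut_star_eigenvectorUnitary
  rw [Unitary.conjStarAlgAut_star_apply] at this
  exact this

/-- The diagonal entries of `Xᴴ diag(c) X`. -/
theorem conjTranspose_mul_diagonal_mul_apply_self {m l : Type*} [Fintype m] [DecidableEq m]
    (c : m → ℝ) (X : Matrix m l ℂ) (j : l) :
    (Xᴴ * diagonal (fun i => (c i : ℂ)) * X) j j = ((∑ i, c i * ‖X i j‖ ^ 2 : ℝ) : ℂ) := by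
  rw [mul_apply, Complex.ofReal_sum]
  refine Finset.sum_congr rfl fun i _ => ?_
  rw [mul_diagonal, conjTranspose_apply, RCLike.star_def]
  push_cast
  rw [← Complex.conj_mul']
  ring

theorem self_mul_conjTranspose_apply_self {m l : Type*} [Fintype l] (Q : Matrix m l ℂ) (i : m) :
    (Q * Qᴴ) i i = ((∑ j, ‖Q i j‖ ^ 2 : ℝ) : ℂ) := by
  rw [mul_apply, Complex.ofReal_sum]
  refine Finset.sum_congr rfl fun j _ => ?_
  rw [conjTranspose_apply, RCLike.star_def, Complex.mul_conj']
  push_cast; rfl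

theorem star_dotProduct_diagonal_mulVec {m : Type*} [Fintype m] [DecidableEq m] (c : m → ℝ)
    (u : m → ℂ) : star u ⬝ᵥ (diagonal (fun i => (c i : ℂ)) *ᵥ u) =
      ((∑ i, c i * ‖u i‖ ^ 2 : ℝ) : ℂ) := by
  rw [dotProduct, Complex.ofReal_sum]
  refine Finset.sum_congr rfl fun i _ => ?_
  rw [mulVec_diagonal, Pi.star_apply, RCLike.star_def]
  push_cast
  rw [← Complex.conj_mul']
  ring

/-- The rows of a matrix with orthonormal columns have norm at most `1`. -/
theorem sum_norm_sq_row_le_one {m l : Type*} [Fintype m] [Fintype l] [DecidableEq l]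
    (Z : Matrix m l ℂ) (hZ : Zᴴ * Z = 1) (i : m) : ∑ j, ‖Z i j‖ ^ 2 ≤ 1 := by
  classical
  set h : ℝ := ∑ j, ‖Z i j‖ ^ 2
  -- the projection `P = Z Zᴴ` satisfies `P = P Pᴴ`, so a diagonal entry `h` has `h² ≤ h`
  have hP : Z * Zᴴ = (Z * Zᴴ) * (Z * Zᴴ)ᴴ := by
    rw [conjTranspose_mul, conjTranspose_conjTranspose, Matrix.mul_assoc, ← Matrix.mul_assoc Zᴴ,
      hZ, Matrix.one_mul]
  have h1 : h = ∑ j, ‖(Z * Zᴴ) i j‖ ^ 2 := by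
    have := congrFun (congrFun hP i) i
    rw [self_mul_conjTranspose_apply_self, self_mul_conjTranspose_apply_self] at this
    exact_mod_cast this
  have h2 : h ^ 2 ≤ h := by
    conv_rhs => rw [h1]
    have : ‖(Z * Zᴴ) i i‖ ^ 2 = h ^ 2 := by
      rw [self_mul_conjTranspose_apply_self, Complex.norm_real, Real.norm_eq_abs, sq_abs]
    rw [← this]
    exact Finset.single_le_sum (f := fun j => ‖(Z * Zᴴ) i j‖ ^ 2) (fun _ _ => sq_nonneg _)
      (Finset.mem_univ i)
  nlinarith

/-- **Sylvester's law of inertia**, as an inequality for one sign `s`: a congruence, possibly by a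
singular or rectangular matrix, cannot increase the number of diagonal entries of that sign. -/
theorem card_pos_le_of_congruence {m l : Type*} [Fintype m] [DecidableEq m] [Fintype l]
    [DecidableEq l] (a : m → ℝ) (b : l → ℝ) (Y : Matrix m l ℂ)
    (h : Yᴴ * diagonal (fun i => (a i : ℂ)) * Y = diagonal fun i => (b i : ℂ)) (s : ℝ) :
    (Finset.univ.filter fun i => 0 < s * b i).card ≤
      (Finset.univ.filter fun i => 0 < s * a i).card := by
  by_contra! hlt
  rw [← Fintype.card_subtype, ← Fintype.card_subtype] at hlt
  -- a nonzero combination of the columns with `s * b > 0` vanishes on all rows with `s * a > 0`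
  set N : Matrix {i // 0 < s * a i} {i // 0 < s * b i} ℂ := Y.submatrix (↑) (↑)
  obtain ⟨v, hv, hv0⟩ := (Submodule.ne_bot_iff _).1
    (N.mulVecLin.ker_ne_bot_of_finrank_lt (by simpa using hlt))
  set w : l → ℂ := fun i => if hi : 0 < s * b i then v ⟨i, hi⟩ else 0
  have hw : ∀ j : {i // 0 < s * a i}, (Y *ᵥ w) j = 0 := by
    intro j
    have h1 : (N *ᵥ v) j = 0 := by
      have : N *ᵥ v = 0 := hv
      rw [this]; rfl
    rw [← h1, mulVec, mulVec, dotProduct, dotProduct,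
      ← Fintype.sum_subtype_add_sum_subtype (fun i => 0 < s * b i)]
    rw [Finset.sum_eq_zero (s := (Finset.univ : Finset {i // ¬ 0 < s * b i}))
      (fun i _ => by simp [w, i.2]), add_zero]
    refine Finset.sum_congr rfl fun i _ => ?_
    have hi := i.2
    simp only [w, dif_pos hi]; rfl
  have e : ∑ i, b i * ‖w i‖ ^ 2 = ∑ i, a i * ‖(Y *ᵥ w) i‖ ^ 2 := by
    have := star_dotProduct_diagonal_mulVec b w
    rw [← h, ← mulVec_mulVec, ← mulVec_mulVec, dotProduct_mulVec, ← star_mulVec,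
      star_dotProduct_diagonal_mulVec] at this
    exact_mod_cast this.symm
  have e1 : s * ∑ i, a i * ‖(Y *ᵥ w) i‖ ^ 2 ≤ 0 := by
    rw [Finset.mul_sum]
    refine Finset.sum_nonpos fun i _ => ?_
    by_cases hi : 0 < s * a i
    · simp [hw ⟨i, hi⟩]
    · rw [← mul_assoc]
      exact mul_nonpos_of_nonpos_of_nonneg (not_lt.1 hi) (sq_nonneg _)
  have e2 : 0 < s * ∑ i, b i * ‖w i‖ ^ 2 := by
    rw [Finset.mul_sum]
    obtain ⟨j, hj⟩ := Function.ne_iff.1 hv0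
    refine Finset.sum_pos' (fun i _ => ?_) ⟨j, Finset.mem_univ _, ?_⟩
    · by_cases hi : 0 < s * b i
      · rw [← mul_assoc]; positivity
      · simp [w, hi]
    · have hj' := j.2
      have : w j ≠ 0 := by simpa [w, hj'] using hj
      rw [← mul_assoc]; positivity
  rw [e] at e2
  linarith

/-! ### The trace inequality for diagonal pencils -/

/-- If the Gram matrix of the columns of `Y` is at least the identity, the trace of `Yᴴ diag(γ) Y`
is at least the sum of the smallest entries of `γ`, as many as `Y` has columns. -/
theorem sum_castLE_le_sum_norm_sq {p k : ℕ} (hk : k ≤ p) (γ : Fin p → ℝ) (hγ : Monotone γ)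
    (h0 : ∀ l, 0 ≤ γ l) (Y : Matrix (Fin p) (Fin k) ℂ) (hY : (Yᴴ * Y - 1).PosSemidef) :
    ∑ i : Fin k, γ (Fin.castLE hk i) ≤ ∑ j, ∑ l, γ l * ‖Y l j‖ ^ 2 := by
  have hM : (Yᴴ * Y).IsHermitian := isHermitian_conjTranspose_mul_self Y
  obtain ⟨V, hV1, hV2, hV⟩ := exists_unitary_diagonal hM
  set m := hM.eigenvalues
  have hm : ∀ j, 1 ≤ m j := by
    have h1 := hY.conjTranspose_mul_mul_same V
    have h2 : Vᴴ * (Yᴴ * Y - 1) * V = diagonal fun i => ((m i - 1 : ℝ) : ℂ) := by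
      rw [Matrix.mul_sub, Matrix.sub_mul, hV, Matrix.mul_one, hV1, ← diagonal_one, diagonal_sub]
      simp
    rw [h2, posSemidef_diagonal_iff] at h1
    intro j
    have := Complex.zero_le_real.1 (h1 j)
    linarith
  -- rotate the columns of `Y` to be orthogonal and normalise them; their norms were at least `1`
  set Y₁ := Y * V with hY₁
  set Z := Y₁ * diagonal fun j => ((1 / √(m j) : ℝ) : ℂ) with hZdef
  have hZ : Zᴴ * Z = 1 := by
    have h1 : Zᴴ * Z = diagonal (fun j => ((1 / √(m j) : ℝ) : ℂ)) * (Vᴴ * (Yᴴ * Y) * V) *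
        diagonal fun j => ((1 / √(m j) : ℝ) : ℂ) := by
      rw [hZdef, hY₁, conjTranspose_mul, conjTranspose_mul, diagonal_conjTranspose]
      have : star (fun j => ((1 / √(m j) : ℝ) : ℂ)) = fun j => ((1 / √(m j) : ℝ) : ℂ) := by
        ext j; simp
      rw [this]
      simp only [Matrix.mul_assoc]
    rw [h1, hV, diagonal_mul_diagonal, diagonal_mul_diagonal, ← diagonal_one]
    congr 1
    ext j
    have h2 : 0 < m j := by linarith [hm j]
    rw [← Complex.ofReal_mul, ← Complex.ofReal_mul, ← Complex.ofReal_one]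
    congr 1
    have := Real.mul_self_sqrt h2.le
    have h3 : √(m j) ≠ 0 := (Real.sqrt_pos.2 h2).ne'
    field_simp
    nlinarith
  have hYZ : ∀ l j, ‖Z l j‖ ^ 2 ≤ ‖Y₁ l j‖ ^ 2 := by
    intro l j
    rw [hZdef, mul_diagonal, norm_mul, Complex.norm_real, mul_pow, Real.norm_eq_abs, sq_abs,
      div_pow, one_pow, Real.sq_sqrt (by linarith [hm j])]
    exact mul_le_of_le_one_right (sq_nonneg _) ((div_le_one (by linarith [hm j])).2 (hm j))
  have hrow : ∀ l, ∑ j, ‖Y l j‖ ^ 2 = ∑ j, ‖Y₁ l j‖ ^ 2 := by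
    intro l
    have : Y * Yᴴ = Y₁ * Y₁ᴴ := by
      rw [hY₁, conjTranspose_mul, Matrix.mul_assoc, ← Matrix.mul_assoc V, hV2, Matrix.one_mul]
    have := congrFun (congrFun this l) l
    rw [self_mul_conjTranspose_apply_self, self_mul_conjTranspose_apply_self] at this
    exact_mod_cast this
  have hs : ∑ l, ∑ j, ‖Z l j‖ ^ 2 = k := by
    rw [Finset.sum_comm]
    have : ∀ j, ∑ l, ‖Z l j‖ ^ 2 = 1 := by
      intro j
      have h1 := conjTranspose_mul_diagonal_mul_apply_self (fun _ => 1) Z j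
      simp only [Complex.ofReal_one, diagonal_one, Matrix.mul_one, hZ, one_apply_eq, one_mul] at h1
      exact_mod_cast h1.symm
    simp [this]
  refine (sum_castLE_le_sum_mul hk γ (fun l => ∑ j, ‖Z l j‖ ^ 2) hγ
    (fun l => Finset.sum_nonneg fun _ _ => sq_nonneg _) (sum_norm_sq_row_le_one Z hZ) hs).trans ?_
  rw [Finset.sum_comm]
  refine Finset.sum_le_sum fun l _ => ?_
  rw [← Finset.mul_sum, hrow]
  exact mul_le_mul_of_nonneg_left (Finset.sum_le_sum fun j _ => hYZ l j) (h0 l)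

/-- The weighted form of `sum_castLE_le_sum_norm_sq`, obtained from it, applied to the leading
columns, by summation by parts. -/
theorem sum_mul_castLE_le_sum_norm_sq {p k : ℕ} (hk : k ≤ p) (γ : Fin p → ℝ) (hγ : Monotone γ)
    (h0 : ∀ l, 0 ≤ γ l) (Y : Matrix (Fin p) (Fin k) ℂ) (hY : (Yᴴ * Y - 1).PosSemidef)
    (ω : Fin k → ℝ) (hω : Antitone ω) (hω0 : ∀ i, 0 ≤ ω i) :
    ∑ i, ω i * γ (Fin.castLE hk i) ≤ ∑ j, ω j * ∑ l, γ l * ‖Y l j‖ ^ 2 := by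
  have := mul_sum_le_sum_mul_of_partialSums_nonneg ω
    (fun j => ∑ l, γ l * ‖Y l j‖ ^ 2 - γ (Fin.castLE hk j)) hω ?_ 0 hω0
  · simp only [zero_mul, mul_sub, Finset.sum_sub_distrib] at this
    linarith
  · intro m hm
    have h1 := hY.submatrix (Fin.castLE hm)
    have h2 : (Yᴴ * Y - 1).submatrix (Fin.castLE hm) (Fin.castLE hm) =
        (Y.submatrix id (Fin.castLE hm))ᴴ * Y.submatrix id (Fin.castLE hm) - 1 := by
      rw [← submatrix_one (Fin.castLE hm) (Fin.castLE_injective hm)]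
      rfl
    rw [h2] at h1
    have := sum_castLE_le_sum_norm_sq (hm.trans hk) γ hγ h0 _ h1
    rw [Finset.sum_sub_distrib, sub_nonneg]
    exact this

/-- `e` lists the indices at which `b` is positive, in the order of increasing ratio `c / b`. -/
structure IsSortedRatio {n p : ℕ} (b c : Fin n → ℝ) (e : Fin p → Fin n) : Prop where
  injective : Function.Injective e
  pos : ∀ i, 0 < b (e i)
  exists_eq : ∀ j, 0 < b j → ∃ i, e i = j
  monotone : Monotone fun i => c (e i) / b (e i)

theorem exists_isSortedRatio {n p : ℕ} (b c : Fin n → ℝ)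
    (hp : (Finset.univ.filter fun i => 0 < b i).card = p) :
    ∃ e : Fin p → Fin n, IsSortedRatio b c e := by
  rw [← Fintype.card_subtype] at hp
  obtain ⟨g⟩ := Fintype.card_eq.1 ((Fintype.card_fin p).trans hp.symm)
  set σ := Tuple.sort fun i => c (g i) / b (g i)
  refine ⟨fun i => g (σ i), fun i j h => ?_, fun i => (g (σ i)).2, fun j hj => ?_,
    Tuple.monotone_sort fun i => c (g i) / b (g i)⟩
  · simpa using Subtype.ext h
  · exact ⟨σ.symm (g.symm ⟨j, hj⟩), by simp⟩

namespace IsSortedRatio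

variable {n p k : ℕ} {b c : Fin n → ℝ} {e : Fin p → Fin n}

theorem sum_comp {M : Type*} [AddCommMonoid M] (he : IsSortedRatio b c e) (f : Fin n → M) :
    ∑ l, f (e l) = ∑ i, if 0 < b i then f i else 0 := by
  rw [← Finset.sum_filter]
  refine Finset.sum_bij (fun i _ => e i) (by simp [he.pos]) (fun i _ j _ h => he.injective h) ?_
    (by simp)
  intro l hl
  obtain ⟨i, hi⟩ := he.exists_eq l (by simpa using hl)
  exact ⟨i, by simp, hi⟩

theorem prod_comp {M : Type*} [CommMonoid M] (he : IsSortedRatio b c e) (f : Fin n → M) :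
    ∏ l, f (e l) = ∏ i, if 0 < b i then f i else 1 :=
  he.sum_comp (M := Additive M) f

/-- The trace inequality for columns that are orthonormal in the indefinite product of `diag(b)`.
Dropping the rows with `b ≤ 0` and scaling the others by `√b` leaves columns whose Gram matrix is
at least the identity. -/
theorem sum_le (he : IsSortedRatio b c e) (hc : ∀ i, 0 ≤ c i) (hk : k ≤ p)
    (X : Matrix (Fin n) (Fin k) ℂ) (hX : Xᴴ * diagonal (fun i => (b i : ℂ)) * X = 1)
    (ω : Fin k → ℝ) (hω : Antitone ω) (hω0 : ∀ i, 0 ≤ ω i) :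
    ∑ i, ω i * (c (e (Fin.castLE hk i)) / b (e (Fin.castLE hk i))) ≤
      ∑ j, ω j * ∑ i, c i * ‖X i j‖ ^ 2 := by
  set Y : Matrix (Fin p) (Fin k) ℂ := of fun l j => (√(b (e l)) : ℂ) * X (e l) j with hYdef
  have hY : (Yᴴ * Y - 1).PosSemidef := by
    have h1 : Yᴴ * Y - 1 = Xᴴ * diagonal (fun i => ((max (-b i) 0 : ℝ) : ℂ)) * X := by
      rw [← hX]
      ext i j
      rw [Matrix.sub_apply, mul_apply, mul_apply, mul_apply]
      simp only [mul_diagonal, conjTranspose_apply, hYdef, of_apply]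
      rw [he.sum_comp fun l => star ((√(b l) : ℂ) * X l i) * ((√(b l) : ℂ) * X l j),
        ← Finset.sum_sub_distrib]
      refine Finset.sum_congr rfl fun l _ => ?_
      split_ifs with hl
      · rw [max_eq_right (by linarith)]
        have : (√(b l) : ℂ) * √(b l) = b l := by
          rw [← Complex.ofReal_mul, Real.mul_self_sqrt hl.le]
        simp only [star_mul', RCLike.star_def, Complex.conj_ofReal]
        rw [← this]
        push_cast
        ring
      · rw [max_eq_left (by linarith)]
        push_cast
        ring
    rw [h1]
    refine PosSemidef.conjTranspose_mul_mul_same (PosSemidef.diagonal fun i => ?_) X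
    exact Complex.zero_le_real.2 (le_max_right _ _)
  refine (sum_mul_castLE_le_sum_norm_sq hk (fun l => c (e l) / b (e l)) he.monotone
    (fun l => div_nonneg (hc _) (he.pos l).le) Y hY ω hω hω0).trans ?_
  refine Finset.sum_le_sum fun j _ => mul_le_mul_of_nonneg_left ?_ (hω0 j)
  have h2 : ∀ l, c (e l) / b (e l) * ‖Y l j‖ ^ 2 = c (e l) * ‖X (e l) j‖ ^ 2 := by
    intro l
    have := (he.pos l).ne'
    rw [hYdef, of_apply, norm_mul, mul_pow, Complex.norm_real, Real.norm_eq_abs, sq_abs,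
      Real.sq_sqrt (he.pos l).le]
    field_simp
  simp only [h2]
  rw [he.sum_comp fun i => c i * ‖X i j‖ ^ 2]
  refine Finset.sum_le_sum fun i _ => ?_
  split_ifs
  · exact le_rfl
  · exact mul_nonneg (hc i) (sq_nonneg _)

end IsSortedRatio

theorem signMatrix_eq_diagonal (p q : ℕ) :
    signMatrix p q = diagonal (Sum.elim (fun _ => 1) fun _ => -1) := by
  rw [signMatrix, ← fromBlocks_diagonal]
  congr 1
  ext i j
  simp [diagonal_apply, one_apply, apply_ite]

theorem trace_fromBlocks_diagonal_mul {p q : ℕ} (ωp : Fin p → ℝ) (ωm : Fin q → ℝ)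
    (M : Matrix (Fin p ⊕ Fin q) (Fin p ⊕ Fin q) ℂ) :
    (fromBlocks (diagonal fun i => (ωp i : ℂ)) 0 0 (diagonal fun i => (ωm i : ℂ)) * M).trace =
      ∑ i, (ωp i : ℂ) * M (.inl i) (.inl i) + ∑ i, (ωm i : ℂ) * M (.inr i) (.inr i) := by
  rw [fromBlocks_diagonal, trace]
  simp [diagonal_mul]

/-- The congruence of `diag(b)` by the matrix whose column `x` is `r x` times the unit vector at
`g x`. -/
theorem scaledColumns_congruence {n : ℕ} {κ : Type*} [Fintype κ] [DecidableEq κ] (b : Fin n → ℝ)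
    (g : κ → Fin n) (hg : Function.Injective g) (r : κ → ℝ) :
    (of fun i x => if i = g x then (r x : ℂ) else 0)ᴴ * diagonal (fun i => (b i : ℂ)) *
      (of fun i x => if i = g x then (r x : ℂ) else 0) =
    diagonal fun x => ((b (g x) * r x ^ 2 : ℝ) : ℂ) := by
  ext x y
  rw [mul_apply]
  simp only [mul_diagonal, conjTranspose_apply, of_apply, diagonal_apply, mul_ite, mul_zero,
    Finset.sum_ite_eq', Finset.mem_univ, if_true]
  by_cases h : x = y
  · subst h
    simp
    ring
  · have : g y ≠ g x := fun h' => h (hg h').symm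
    simp [h, this]

/-- The trace minimisation for a diagonal pencil with non-negative first coefficient: the
minimum exists, and it is attained at scaled unit vectors. -/
theorem isLeast_traceValues_diagonal {n p q kp km : ℕ} {b c : Fin n → ℝ} {ep : Fin p → Fin n}
    {em : Fin q → Fin n} (hep : IsSortedRatio b c ep) (hem : IsSortedRatio (-b) c em)
    (hc : ∀ i, 0 ≤ c i) (hkp : kp ≤ p) (hkm : km ≤ q)
    (ωp : Fin kp → ℝ) (hωp : Antitone ωp) (hωp0 : ∀ i, 0 ≤ ωp i)
    (ωm : Fin km → ℝ) (hωm : Antitone ωm) (hωm0 : ∀ i, 0 ≤ ωm i) :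
    IsLeast (traceValues (diagonal fun i => (c i : ℂ)) (diagonal fun i => (b i : ℂ))
        (diagonal fun i => (ωp i : ℂ)) (diagonal fun i => (ωm i : ℂ)))
      (∑ i, ωp i * (c (ep (Fin.castLE hkp i)) / b (ep (Fin.castLE hkp i))) +
        ∑ i, ωm i * (c (em (Fin.castLE hkm i)) / (-b) (em (Fin.castLE hkm i)))) := by
  constructor
  · set g : Fin kp ⊕ Fin km → Fin n :=
      Sum.elim (fun i => ep (Fin.castLE hkp i)) fun i => em (Fin.castLE hkm i) with hgdef
    have hg : Function.Injective g := by
      refine Function.Injective.sumElim (hep.injective.comp (Fin.castLE_injective hkp))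
        (hem.injective.comp (Fin.castLE_injective hkm)) fun i j h => ?_
      have h1 := hep.pos (Fin.castLE hkp i)
      have h2 := hem.pos (Fin.castLE hkm j)
      rw [← h, Pi.neg_apply] at h2
      linarith
    refine ⟨of fun i x => if i = g x then ((1 / √|b (g x)| : ℝ) : ℂ) else 0, ?_, ?_⟩
    · rw [scaledColumns_congruence b g hg fun x => 1 / √|b (g x)|, signMatrix_eq_diagonal]
      congr 1
      ext (i | i)
      · have h1 := hep.pos (Fin.castLE hkp i)
        rw [div_pow, Real.sq_sqrt (abs_nonneg _)]
        simp only [hgdef, Sum.elim_inl]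
        rw [abs_of_pos h1, one_pow, mul_one_div_cancel h1.ne', Complex.ofReal_one]
      · have h1 := hem.pos (Fin.castLE hkm i)
        rw [Pi.neg_apply] at h1
        rw [div_pow, Real.sq_sqrt (abs_nonneg _)]
        simp only [hgdef, Sum.elim_inr]
        rw [abs_of_neg (by linarith), one_pow, mul_one_div, div_neg, div_self (by linarith),
          Complex.ofReal_neg, Complex.ofReal_one]
    · rw [scaledColumns_congruence c g hg fun x => 1 / √|b (g x)|, trace_fromBlocks_diagonal_mul,
        Complex.ofReal_add, Complex.ofReal_sum, Complex.ofReal_sum]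
      congr 1
      · refine Finset.sum_congr rfl fun i _ => ?_
        have h1 := hep.pos (Fin.castLE hkp i)
        rw [diagonal_apply_eq, div_pow, Real.sq_sqrt (abs_nonneg _)]
        simp only [hgdef, Sum.elim_inl]
        rw [abs_of_pos h1]
        push_cast; ring
      · refine Finset.sum_congr rfl fun i _ => ?_
        have h1 := hem.pos (Fin.castLE hkm i)
        rw [Pi.neg_apply] at h1
        rw [diagonal_apply_eq, div_pow, Real.sq_sqrt (abs_nonneg _)]
        simp only [hgdef, Sum.elim_inr]
        rw [abs_of_neg (by linarith), Pi.neg_apply]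
        push_cast; ring
  · rintro t ⟨X, hX, ht⟩
    have h1 := hep.sum_le hc hkp (X.submatrix id .inl)
      (by
        have : (Xᴴ * diagonal (fun i => (b i : ℂ)) * X).submatrix Sum.inl Sum.inl = 1 := by
          rw [hX, signMatrix]; rfl
        exact this) ωp hωp hωp0
    have h2 := hem.sum_le hc hkm (X.submatrix id .inr)
      (by
        have : (Xᴴ * diagonal (fun i => (b i : ℂ)) * X).submatrix Sum.inr Sum.inr = -1 := by
          rw [hX, signMatrix]; rfl
        have h3 : diagonal (fun i => (((-b) i : ℝ) : ℂ)) = -diagonal fun i => (b i : ℂ) := by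
          rw [diagonal_neg]; simp
        rw [h3, Matrix.mul_neg, Matrix.neg_mul]
        exact neg_eq_iff_eq_neg.2 this) ωm hωm hωm0
    have h3 : t = ∑ j, ωp j * ∑ i, c i * ‖X i (.inl j)‖ ^ 2 +
        ∑ j, ωm j * ∑ i, c i * ‖X i (.inr j)‖ ^ 2 := by
      rw [trace_fromBlocks_diagonal_mul] at ht
      simp only [conjTranspose_mul_diagonal_mul_apply_self] at ht
      exact_mod_cast ht.symm
    rw [h3]
    exact add_le_add h1 h2

/-! ### Congruence and inertia -/

/-- `X ↦ W X` carries the admissible matrices of the compressed pencil to those of the pencil. -/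
theorem traceValues_congruence_subset {n m p q : ℕ} (W : Matrix (Fin n) (Fin m) ℂ)
    (A B : Matrix (Fin n) (Fin n) ℂ) (Dp : Matrix (Fin p) (Fin p) ℂ)
    (Dm : Matrix (Fin q) (Fin q) ℂ) :
    traceValues (Wᴴ * A * W) (Wᴴ * B * W) Dp Dm ⊆ traceValues A B Dp Dm := by
  have e : ∀ (X : Matrix (Fin m) (Fin p ⊕ Fin q) ℂ) (M : Matrix (Fin n) (Fin n) ℂ),
      (W * X)ᴴ * M * (W * X) = Xᴴ * (Wᴴ * M * W) * X := by
    intro X M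
    simp only [conjTranspose_mul, Matrix.mul_assoc]
  rintro t ⟨X, hX, ht⟩
  exact ⟨W * X, by rw [e, hX], by rw [e, ht]⟩

theorem eq_inv_congruence {n : ℕ} {U : Matrix (Fin n) (Fin n) ℂ} (hU : IsUnit U.det)
    {A A' : Matrix (Fin n) (Fin n) ℂ} (h : Uᴴ * A * U = A') : A = (U⁻¹)ᴴ * A' * U⁻¹ := by
  have h1 : (U⁻¹)ᴴ * Uᴴ = 1 := by
    rw [← conjTranspose_mul, mul_nonsing_inv _ hU, conjTranspose_one]
  rw [← h]
  calc A = 1 * A * 1 := by simp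
    _ = ((U⁻¹)ᴴ * Uᴴ) * A * (U * U⁻¹) := by rw [h1, mul_nonsing_inv _ hU]
    _ = _ := by simp only [Matrix.mul_assoc]

theorem traceValues_eq_of_congruence {n p q : ℕ} {U : Matrix (Fin n) (Fin n) ℂ}
    (hU : IsUnit U.det) {A B A' B' : Matrix (Fin n) (Fin n) ℂ} (hA : Uᴴ * A * U = A')
    (hB : Uᴴ * B * U = B') (Dp : Matrix (Fin p) (Fin p) ℂ) (Dm : Matrix (Fin q) (Fin q) ℂ) :
    traceValues A B Dp Dm = traceValues A' B' Dp Dm := by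
  apply subset_antisymm
  · conv_lhs => rw [eq_inv_congruence hU hA, eq_inv_congruence hU hB]
    exact traceValues_congruence_subset _ _ _ _ _
  · rw [← hA, ← hB]
    exact traceValues_congruence_subset _ _ _ _ _

theorem card_pos_eigenvalues_le_of_congruence {n m : ℕ} {B : Matrix (Fin n) (Fin n) ℂ}
    {B' : Matrix (Fin m) (Fin m) ℂ} (hB : B.IsHermitian) (hB' : B'.IsHermitian)
    (Y : Matrix (Fin n) (Fin m) ℂ) (h : Yᴴ * B * Y = B') (s : ℝ) :
    (Finset.univ.filter fun i => 0 < s * hB'.eigenvalues i).card ≤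
      (Finset.univ.filter fun i => 0 < s * hB.eigenvalues i).card := by
  obtain ⟨V, hV1, hV2, hV⟩ := exists_unitary_diagonal hB
  obtain ⟨V', hV1', hV2', hV'⟩ := exists_unitary_diagonal hB'
  refine card_pos_le_of_congruence _ _ (Vᴴ * Y * V') ?_ s
  rw [← hV, ← hV', ← h]
  simp only [conjTranspose_mul, conjTranspose_conjTranspose, Matrix.mul_assoc]
  rw [← Matrix.mul_assoc V Vᴴ, hV2, Matrix.one_mul, ← Matrix.mul_assoc V Vᴴ, hV2, Matrix.one_mul]

theorem numPosEig_le_of_congruence {n m : ℕ} {B : Matrix (Fin n) (Fin n) ℂ}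
    {B' : Matrix (Fin m) (Fin m) ℂ} (hB : B.IsHermitian) (hB' : B'.IsHermitian)
    (Y : Matrix (Fin n) (Fin m) ℂ) (h : Yᴴ * B * Y = B') : numPosEig hB' ≤ numPosEig hB := by
  simpa [numPosEig] using card_pos_eigenvalues_le_of_congruence hB hB' Y h 1

theorem numNegEig_le_of_congruence {n m : ℕ} {B : Matrix (Fin n) (Fin n) ℂ}
    {B' : Matrix (Fin m) (Fin m) ℂ} (hB : B.IsHermitian) (hB' : B'.IsHermitian)
    (Y : Matrix (Fin n) (Fin m) ℂ) (h : Yᴴ * B * Y = B') : numNegEig hB' ≤ numNegEig hB := by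
  simpa [numNegEig] using card_pos_eigenvalues_le_of_congruence hB hB' Y h (-1)

theorem card_pos_eq_card_pos_eigenvalues {n : ℕ} {B U : Matrix (Fin n) (Fin n) ℂ}
    (hB : B.IsHermitian) (hU : IsUnit U.det) {b : Fin n → ℝ}
    (h : Uᴴ * B * U = diagonal fun i => (b i : ℂ)) (s : ℝ) :
    (Finset.univ.filter fun i => 0 < s * b i).card =
      (Finset.univ.filter fun i => 0 < s * hB.eigenvalues i).card := by
  obtain ⟨V, hV1, hV2, hV⟩ := exists_unitary_diagonal hB
  apply le_antisymm
  · refine card_pos_le_of_congruence _ _ (Vᴴ * U) ?_ s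
    rw [← hV, ← h]
    simp only [conjTranspose_mul, conjTranspose_conjTranspose, Matrix.mul_assoc]
    rw [← Matrix.mul_assoc V Vᴴ, hV2, Matrix.one_mul, ← Matrix.mul_assoc V Vᴴ, hV2,
      Matrix.one_mul]
  · refine card_pos_le_of_congruence _ _ (U⁻¹ * V) ?_ s
    rw [← hV, conjTranspose_mul]
    conv_rhs => rw [eq_inv_congruence hU h]
    simp only [Matrix.mul_assoc]

/-- The numbers of positive and negative eigenvalues of `B` can be read off from any
diagonalization of `B` by congruence. -/
theorem exists_isSortedRatio_of_congruence {n : ℕ} {B U : Matrix (Fin n) (Fin n) ℂ}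
    (hB : B.IsHermitian) (hU : IsUnit U.det) {b : Fin n → ℝ}
    (h : Uᴴ * B * U = diagonal fun i => (b i : ℂ)) (c : Fin n → ℝ) :
    (∃ ep : Fin (numPosEig hB) → Fin n, IsSortedRatio b c ep) ∧
      ∃ em : Fin (numNegEig hB) → Fin n, IsSortedRatio (-b) c em :=
  ⟨exists_isSortedRatio b c (by
    simpa [numPosEig] using card_pos_eq_card_pos_eigenvalues hB hU h 1),
  exists_isSortedRatio (-b) c (by
    simpa [numNegEig] using card_pos_eq_card_pos_eigenvalues hB hU h (-1))⟩

/-! ### Definite pencils -/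

theorem exists_congruence_one_diagonal {n : ℕ} {C B : Matrix (Fin n) (Fin n) ℂ} (hC : C.PosDef)
    (hB : B.IsHermitian) : ∃ (U : Matrix (Fin n) (Fin n) ℂ) (b : Fin n → ℝ), IsUnit U.det ∧
      Uᴴ * C * U = 1 ∧ Uᴴ * B * U = diagonal fun i => (b i : ℂ) := by
  obtain ⟨V, hV1, hV2, hV⟩ := exists_unitary_diagonal hC.isHermitian
  set e := hC.isHermitian.eigenvalues
  have he : ∀ i, 0 < e i := hC.eigenvalues_pos
  set S := V * diagonal fun j => ((1 / √(e j) : ℝ) : ℂ) with hS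
  have hSC : Sᴴ * C * S = 1 := by
    have h1 : Sᴴ * C * S = diagonal (fun j => ((1 / √(e j) : ℝ) : ℂ)) * (Vᴴ * C * V) *
        diagonal fun j => ((1 / √(e j) : ℝ) : ℂ) := by
      rw [hS, conjTranspose_mul, diagonal_conjTranspose]
      have : star (fun j => ((1 / √(e j) : ℝ) : ℂ)) = fun j => ((1 / √(e j) : ℝ) : ℂ) := by
        ext j; simp
      rw [this]
      simp only [Matrix.mul_assoc]
    rw [h1, hV, diagonal_mul_diagonal, diagonal_mul_diagonal, ← diagonal_one]
    congr 1
    ext j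
    rw [← Complex.ofReal_mul, ← Complex.ofReal_mul, ← Complex.ofReal_one]
    congr 1
    have := Real.mul_self_sqrt (he j).le
    have h3 : √(e j) ≠ 0 := (Real.sqrt_pos.2 (he j)).ne'
    field_simp
    nlinarith
  have hSB : (Sᴴ * B * S).IsHermitian := isHermitian_conjTranspose_mul_mul S hB
  obtain ⟨V₂, hV₂1, hV₂2, hV₂⟩ := exists_unitary_diagonal hSB
  have hU : (S * V₂)ᴴ * C * (S * V₂) = 1 := by
    rw [← hV₂1]
    calc (S * V₂)ᴴ * C * (S * V₂) = V₂ᴴ * (Sᴴ * C * S) * V₂ := by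
          simp only [conjTranspose_mul, Matrix.mul_assoc]
      _ = V₂ᴴ * V₂ := by rw [hSC, Matrix.mul_one]
  refine ⟨S * V₂, hSB.eigenvalues, ?_, hU, ?_⟩
  · have := congrArg det hU
    rw [det_mul, det_one] at this
    exact IsUnit.of_mul_eq_one_right _ this
  · rw [← hV₂]
    simp only [conjTranspose_mul, Matrix.mul_assoc]

/-- A positive definite matrix `C` paired with a Hermitian `B`: the trace minimum in terms of the
positive eigenvalues `gp` and the negated negative eigenvalues `gm` of `C - μ B`. -/
theorem exists_isLeast_traceValues_of_posDef {n : ℕ} {C B : Matrix (Fin n) (Fin n) ℂ}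
    (hC : C.PosDef) (hB : B.IsHermitian) :
    ∃ (gp : Fin (numPosEig hB) → ℝ) (gm : Fin (numNegEig hB) → ℝ),
      Monotone gp ∧ Monotone gm ∧ (∀ i, 0 ≤ gp i) ∧ (∀ i, 0 ≤ gm i) ∧
      (∀ (kp km : ℕ) (hkp : kp ≤ numPosEig hB) (hkm : km ≤ numNegEig hB)
        (ωp : Fin kp → ℝ) (ωm : Fin km → ℝ), Antitone ωp → Antitone ωm → (∀ i, 0 ≤ ωp i) →
        (∀ i, 0 ≤ ωm i) → IsLeast (traceValues C B
          (diagonal fun i => (ωp i : ℂ)) (diagonal fun i => (ωm i : ℂ)))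
          (∑ i, ωp i * gp (Fin.castLE hkp i) + ∑ i, ωm i * gm (Fin.castLE hkm i))) ∧
      ∃ κ : ℂ, ∀ μ : ℂ,
        (C - μ • B).det = κ * ((∏ i, ((gp i : ℂ) - μ)) * ∏ i, ((gm i : ℂ) + μ)) := by
  obtain ⟨U, b, hU, hUC, hUB⟩ := exists_congruence_one_diagonal hC hB
  obtain ⟨⟨ep, hep⟩, em, hem⟩ := exists_isSortedRatio_of_congruence hB hU hUB fun _ => 1
  refine ⟨_, _, hep.monotone, hem.monotone, fun i => div_nonneg zero_le_one (hep.pos i).le,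
    fun i => div_nonneg zero_le_one (hem.pos i).le, ?_, ?_⟩
  · intro kp km hkp hkm ωp ωm hωp hωm hωp0 hωm0
    rw [traceValues_eq_of_congruence hU hUC hUB]
    have := isLeast_traceValues_diagonal hep hem (fun _ => zero_le_one) hkp hkm ωp hωp hωp0 ωm
      hωm hωm0
    simpa only [Complex.ofReal_one, diagonal_one] using this
  · have hdet : IsUnit (Uᴴ.det * U.det) := by
      rw [det_conjTranspose]
      exact hU.star.mul hU
    refine ⟨(∏ i, (b (ep i) : ℂ)) * (∏ i, ((-b) (em i) : ℂ)) / (Uᴴ.det * U.det), fun μ => ?_⟩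
    have h1 : Uᴴ.det * U.det * (C - μ • B).det = ∏ i, (1 - μ * b i) := by
      rw [← det_diagonal, mul_right_comm, ← det_mul, ← det_mul, Matrix.mul_sub, Matrix.sub_mul,
        Matrix.mul_smul, Matrix.smul_mul, hUC, hUB, ← diagonal_one, ← diagonal_smul, diagonal_sub]
      rfl
    have h2 : ∏ i, (1 - μ * b i) =
        (∏ i, ((b (ep i) : ℂ) * (((1 / b (ep i) : ℝ) : ℂ) - μ))) *
          ∏ i, (((-b) (em i) : ℂ) * (((1 / (-b) (em i) : ℝ) : ℂ) + μ)) := by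
      have e1 : ∀ i, (b (ep i) : ℂ) * (((1 / b (ep i) : ℝ) : ℂ) - μ) = 1 - μ * b (ep i) := by
        intro i
        have : (b (ep i) : ℂ) ≠ 0 := Complex.ofReal_ne_zero.2 (hep.pos i).ne'
        push_cast
        field_simp
      have e2 : ∀ i, ((-b) (em i) : ℂ) * (((1 / (-b) (em i) : ℝ) : ℂ) + μ) =
          1 - μ * b (em i) := by
        intro i
        have : (b (em i) : ℂ) ≠ 0 := Complex.ofReal_ne_zero.2 (neg_ne_zero.1 (hem.pos i).ne')
        simp only [Pi.neg_apply]
        push_cast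
        field_simp
        ring
      simp only [e1, e2]
      rw [hep.prod_comp fun i => 1 - μ * (b i : ℂ), hem.prod_comp fun i => 1 - μ * (b i : ℂ),
        ← Finset.prod_mul_distrib]
      refine Finset.prod_congr rfl fun i _ => ?_
      rcases lt_trichotomy (b i) 0 with h | h | h
      · simp [h, not_lt.2 h.le]
      · simp [h]
      · simp [h, not_lt.2 h.le]
    rw [div_mul_eq_mul_div, eq_div_iff hdet.ne_zero, mul_comm, h1, h2, Finset.prod_mul_distrib,
      Finset.prod_mul_distrib]
    ring

/-! ### Semidefinite pencils as limits of definite ones -/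

/-- Along a fixed admissible `X`, the value of the objective for `C + ε` is affine in `ε` with
non-negative slope. -/
theorem exists_slope_traceValues_add_smul {n kp km : ℕ} (C B : Matrix (Fin n) (Fin n) ℂ)
    {ωp : Fin kp → ℝ} {ωm : Fin km → ℝ} (hωp0 : ∀ i, 0 ≤ ωp i) (hωm0 : ∀ i, 0 ≤ ωm i) {δ t : ℝ}
    (ht : t ∈ traceValues (C + (δ : ℂ) • 1) B (diagonal fun i => (ωp i : ℂ))
      (diagonal fun i => (ωm i : ℂ))) :
    ∃ s : ℝ, 0 ≤ s ∧ ∀ ε : ℝ, t + (ε - δ) * s ∈ traceValues (C + (ε : ℂ) • 1) B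
      (diagonal fun i => (ωp i : ℂ)) (diagonal fun i => (ωm i : ℂ)) := by
  obtain ⟨X, hX, ht⟩ := ht
  set s := ∑ j, ωp j * ∑ i, 1 * ‖X i (.inl j)‖ ^ 2 + ∑ j, ωm j * ∑ i, 1 * ‖X i (.inr j)‖ ^ 2
  refine ⟨s, ?_, fun ε => ⟨X, hX, ?_⟩⟩
  · exact add_nonneg
      (Finset.sum_nonneg fun j _ =>
        mul_nonneg (hωp0 j) (Finset.sum_nonneg fun _ _ => by positivity))
      (Finset.sum_nonneg fun j _ =>
        mul_nonneg (hωm0 j) (Finset.sum_nonneg fun _ _ => by positivity))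
  · have h1 : (C + (ε : ℂ) • 1) = (C + (δ : ℂ) • 1) + (((ε - δ : ℝ) : ℂ)) • 1 := by
      rw [add_assoc, ← add_smul]; push_cast; simp
    have h2 : (fromBlocks (diagonal fun i => (ωp i : ℂ)) 0 0 (diagonal fun i => (ωm i : ℂ)) *
        (Xᴴ * (1 : Matrix (Fin n) (Fin n) ℂ) * X)).trace = s := by
      have e : (1 : Matrix (Fin n) (Fin n) ℂ) = diagonal fun _ => ((1 : ℝ) : ℂ) := by simp
      rw [trace_fromBlocks_diagonal_mul, e]
      simp only [conjTranspose_mul_diagonal_mul_apply_self]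
      simp only [s]
      push_cast
      rfl
    rw [h1, Matrix.mul_add, Matrix.add_mul, Matrix.mul_add, trace_add, ht, Matrix.mul_smul,
      Matrix.smul_mul, Matrix.mul_smul, trace_smul, h2]
    push_cast
    rfl

/-- The data of `exists_isLeast_traceValues_of_posDef` for `C + ε` stay bounded as `ε` tends to
`0`, and a limit point describes `C`; the minimum becomes an infimum. The determinant formula
survives because both sides can be normalised at `μ = i`. -/
theorem exists_isGLB_traceValues_of_posSemidef {n : ℕ} {C B : Matrix (Fin n) (Fin n) ℂ}
    (hC : C.PosSemidef) (hB : B.IsHermitian) (hreg : (C - Complex.I • B).det ≠ 0) :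
    ∃ (gp : Fin (numPosEig hB) → ℝ) (gm : Fin (numNegEig hB) → ℝ),
      Monotone gp ∧ Monotone gm ∧ (∀ i, 0 ≤ gp i) ∧ (∀ i, 0 ≤ gm i) ∧
      (∀ (kp km : ℕ) (hkp : kp ≤ numPosEig hB) (hkm : km ≤ numNegEig hB)
        (ωp : Fin kp → ℝ) (ωm : Fin km → ℝ), Antitone ωp → Antitone ωm → (∀ i, 0 ≤ ωp i) →
        (∀ i, 0 ≤ ωm i) → IsGLB (traceValues C B
          (diagonal fun i => (ωp i : ℂ)) (diagonal fun i => (ωm i : ℂ)))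
          (∑ i, ωp i * gp (Fin.castLE hkp i) + ∑ i, ωm i * gm (Fin.castLE hkm i))) ∧
      ∃ κ : ℂ, κ ≠ 0 ∧
        ∀ μ : ℂ, (C - μ • B).det = κ * ((∏ i, ((gp i : ℂ) - μ)) * ∏ i, ((gm i : ℂ) + μ)) := by
  set ε : ℕ → ℝ := fun N => 1 / ((N : ℝ) + 1) with hε
  have hεpos : ∀ N, 0 < ε N := fun N => by positivity
  have hε1 : ∀ N, ε N ≤ 1 := fun N => by
    rw [hε]; exact (div_le_one (by positivity)).2 (by linarith [Nat.cast_nonneg (α := ℝ) N])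
  have hεlim : Filter.Tendsto ε Filter.atTop (nhds 0) := tendsto_one_div_add_atTop_nhds_zero_nat
  have hpd : ∀ N, (C + (ε N : ℂ) • 1).PosDef := fun N =>
    PosDef.posSemidef_add hC (PosDef.one.smul (Complex.zero_lt_real.2 (hεpos N)))
  choose gp gm hgp hgm hgp0 hgm0 hmin κ hκ using
    fun N => exists_isLeast_traceValues_of_posDef (hpd N) hB
  -- boundedness: compare the sum of all entries with its value for `ε = 1`
  set T : ℝ := ∑ i, gp 0 i + ∑ i, gm 0 i
  have hT : ∀ N, ∑ i, gp N i + ∑ i, gm N i ≤ T := by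
    intro N
    have h := fun N => hmin N _ _ le_rfl le_rfl (fun _ => 1) (fun _ => 1) antitone_const
      antitone_const (fun _ => zero_le_one) (fun _ => zero_le_one)
    simp only [one_mul, Fin.castLE_rfl, id] at h
    obtain ⟨s, hs, h1⟩ := exists_slope_traceValues_add_smul C B (fun _ => zero_le_one)
      (fun _ => zero_le_one) (h 0).1
    have h2 := (h N).2 (h1 (ε N))
    have h3 : ε 0 = 1 := by simp [hε]
    rw [h3] at h2
    nlinarith [hε1 N]
  have hmem : ∀ N, (gp N, gm N) ∈ Set.Icc
      ((0, 0) : (Fin (numPosEig hB) → ℝ) × (Fin (numNegEig hB) → ℝ)) (fun _ => T, fun _ => T) := by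
    intro N
    have h1 := Finset.sum_nonneg fun i (_ : i ∈ Finset.univ) => hgp0 N i
    have h2 := Finset.sum_nonneg fun i (_ : i ∈ Finset.univ) => hgm0 N i
    refine ⟨⟨hgp0 N, hgm0 N⟩, ⟨fun i => ?_, fun i => ?_⟩⟩
    · have := Finset.single_le_sum (fun i _ => hgp0 N i) (Finset.mem_univ i)
      have := hT N
      simp only
      linarith
    · have := Finset.single_le_sum (fun i _ => hgm0 N i) (Finset.mem_univ i)
      have := hT N
      simp only
      linarith
  obtain ⟨⟨g, g'⟩, -, φ, hφ, hlim⟩ := isCompact_Icc.tendsto_subseq hmem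
  have hlp : ∀ i, Filter.Tendsto (fun N => gp (φ N) i) Filter.atTop (nhds (g i)) :=
    fun i => (tendsto_pi_nhds.1 ((Prod.tendsto_iff _ _).1 hlim).1) i
  have hlm : ∀ i, Filter.Tendsto (fun N => gm (φ N) i) Filter.atTop (nhds (g' i)) :=
    fun i => (tendsto_pi_nhds.1 ((Prod.tendsto_iff _ _).1 hlim).2) i
  have hεφ := hεlim.comp hφ.tendsto_atTop
  refine ⟨g, g', fun i j hij => le_of_tendsto_of_tendsto' (hlp i) (hlp j) fun N => hgp _ hij,
    fun i j hij => le_of_tendsto_of_tendsto' (hlm i) (hlm j) fun N => hgm _ hij,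
    fun i => ge_of_tendsto' (hlp i) fun N => hgp0 _ i,
    fun i => ge_of_tendsto' (hlm i) fun N => hgm0 _ i, ?_, ?_⟩
  · intro kp km hkp hkm ωp ωm hωp hωm hωp0 hωm0
    have hF := fun N => hmin (φ N) kp km hkp hkm ωp ωm hωp hωm hωp0 hωm0
    have hFlim : Filter.Tendsto (fun N => ∑ i, ωp i * gp (φ N) (Fin.castLE hkp i) +
        ∑ i, ωm i * gm (φ N) (Fin.castLE hkm i)) Filter.atTop
        (nhds (∑ i, ωp i * g (Fin.castLE hkp i) + ∑ i, ωm i * g' (Fin.castLE hkm i))) :=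
      (tendsto_finsetSum _ fun i _ => (hlp _).const_mul _).add
        (tendsto_finsetSum _ fun i _ => (hlm _).const_mul _)
    have hC0 : C + ((0 : ℝ) : ℂ) • (1 : Matrix (Fin n) (Fin n) ℂ) = C := by simp
    constructor
    · intro t ht
      rw [← hC0] at ht
      obtain ⟨s, hs, h1⟩ := exists_slope_traceValues_add_smul C B hωp0 hωm0 ht
      have h2 : Filter.Tendsto (fun N => t + (ε (φ N) - 0) * s) Filter.atTop
          (nhds (t + (0 - 0) * s)) := ((hεφ.sub_const 0).mul_const s).const_add t
      rw [sub_zero, zero_mul, add_zero] at h2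
      exact le_of_tendsto_of_tendsto' hFlim h2 fun N => (hF N).2 (h1 _)
    · intro l hl
      refine ge_of_tendsto' hFlim fun N => ?_
      obtain ⟨s, hs, h1⟩ := exists_slope_traceValues_add_smul C B hωp0 hωm0 (hF N).1
      have h2 := h1 0
      rw [hC0] at h2
      have h3 := hl h2
      nlinarith [hεpos (φ N), mul_nonneg (hεpos (φ N)).le hs]
  · have hne : (∏ i, ((g i : ℂ) - Complex.I)) * ∏ i, ((g' i : ℂ) + Complex.I) ≠ 0 := by
      refine mul_ne_zero (Finset.prod_ne_zero_iff.2 fun i _ h => ?_)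
        (Finset.prod_ne_zero_iff.2 fun i _ h => ?_)
      · simpa using congrArg Complex.im h
      · simpa using congrArg Complex.im h
    refine ⟨(C - Complex.I • B).det /
      ((∏ i, ((g i : ℂ) - Complex.I)) * ∏ i, ((g' i : ℂ) + Complex.I)), div_ne_zero hreg hne,
      fun μ => ?_⟩
    have hp : ∀ μ : ℂ, Filter.Tendsto (fun N => (∏ i, ((gp (φ N) i : ℂ) - μ)) *
        ∏ i, ((gm (φ N) i : ℂ) + μ)) Filter.atTop
        (nhds ((∏ i, ((g i : ℂ) - μ)) * ∏ i, ((g' i : ℂ) + μ))) := by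
      intro μ
      refine (tendsto_finsetProd _ fun i _ => ?_).mul (tendsto_finsetProd _ fun i _ => ?_)
      · exact ((Complex.continuous_ofReal.tendsto _).comp (hlp i)).sub_const μ
      · exact ((Complex.continuous_ofReal.tendsto _).comp (hlm i)).add_const μ
    have hd : ∀ μ : ℂ, Filter.Tendsto (fun N => (C + (ε (φ N) : ℂ) • 1 - μ • B).det) Filter.atTop
        (nhds (C - μ • B).det) := by
      intro μ
      have hcont : Continuous fun x : ℝ => (C + (x : ℂ) • 1 - μ • B).det := by
        refine Continuous.matrix_det ?_
        fun_prop
      have := (hcont.tendsto 0).comp hεφ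
      simpa [Function.comp_def] using this
    have h1 := (hd μ).mul (hp Complex.I)
    have h2 := (hd Complex.I).mul (hp μ)
    have h3 := tendsto_nhds_unique h1 (h2.congr fun N => by
      rw [hκ, hκ (φ N) μ]; ring)
    rw [div_mul_eq_mul_div, eq_div_iff hne]
    exact h3

/-! ### Splitting off the common kernel -/

/-- The kernel of `C + Bᴴ B` is the common kernel of `C` and `B`. -/
theorem mulVec_eq_zero_of_add_conjTranspose_mul_self {n : ℕ} {C B : Matrix (Fin n) (Fin n) ℂ}
    (hC : C.PosSemidef) {x : Fin n → ℂ} (hx : (C + Bᴴ * B) *ᵥ x = 0) :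
    C *ᵥ x = 0 ∧ B *ᵥ x = 0 := by
  have h1 := hC.dotProduct_mulVec_nonneg x
  have h2 := (posSemidef_conjTranspose_mul_self B).dotProduct_mulVec_nonneg x
  have h3 : star x ⬝ᵥ (C *ᵥ x) + star x ⬝ᵥ ((Bᴴ * B) *ᵥ x) = 0 := by
    rw [← dotProduct_add, ← add_mulVec, hx, dotProduct_zero]
  obtain ⟨h4, h5⟩ := (add_eq_zero_iff_of_nonneg h1 h2).1 h3
  refine ⟨(hC.dotProduct_mulVec_zero_iff x).1 h4, ?_⟩
  rw [← mulVec_mulVec, dotProduct_mulVec, ← star_mulVec] at h5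
  exact dotProduct_star_self_eq_zero.1 h5

/-- Every pair of a positive semidefinite `C` and a Hermitian `B` is compressed to the orthogonal
complement of `ker C ∩ ker B` without loss of information, and the compressed pencil is regular.
The columns of `W` are the eigenvectors of `C + B²` for its nonzero eigenvalues. -/
theorem exists_regular_compression {n : ℕ} {C B : Matrix (Fin n) (Fin n) ℂ} (hC : C.PosSemidef)
    (hB : B.IsHermitian) : ∃ (r : ℕ) (W : Matrix (Fin n) (Fin r) ℂ), Wᴴ * W = 1 ∧
      W * (Wᴴ * C * W) * Wᴴ = C ∧ W * (Wᴴ * B * W) * Wᴴ = B ∧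
      (Wᴴ * C * W - Complex.I • (Wᴴ * B * W)).det ≠ 0 := by
  have hH : (C + Bᴴ * B).IsHermitian :=
    (hC.add (posSemidef_conjTranspose_mul_self B)).isHermitian
  obtain ⟨V, hV1, hV2, hV⟩ := exists_unitary_diagonal hH
  set h := hH.eigenvalues
  obtain ⟨e⟩ : Nonempty (Fin (Fintype.card {i // h i ≠ 0}) ≃ {i // h i ≠ 0}) :=
    ⟨(Fintype.equivFin _).symm⟩
  set W : Matrix (Fin n) (Fin (Fintype.card {i // h i ≠ 0})) ℂ :=
    V.submatrix id fun j => (e j : Fin n) with hWdef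
  have hinj : Function.Injective fun j => (e j : Fin n) :=
    Subtype.val_injective.comp e.injective
  have hker : ∀ i, h i = 0 → (C + Bᴴ * B) *ᵥ V.col i = 0 := by
    intro i hi
    have h1 : (C + Bᴴ * B) * V = V * diagonal fun i => (h i : ℂ) := by
      rw [← hV, Matrix.mul_assoc, ← Matrix.mul_assoc V, hV2, Matrix.one_mul]
    ext a
    have := congrFun (congrFun h1 a) i
    rw [mul_diagonal, hi, Complex.ofReal_zero, mul_zero] at this
    exact this
  have hW1 : Wᴴ * W = 1 := by
    have : (Vᴴ * V).submatrix (fun j => (e j : Fin n)) (fun j => (e j : Fin n)) = 1 := by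
      rw [hV1, submatrix_one _ hinj]
    exact this
  have hproj : ∀ M : Matrix (Fin n) (Fin n) ℂ, (∀ i, h i = 0 → M *ᵥ V.col i = 0) →
      M * W * Wᴴ = M := by
    intro M hM
    have h1 : M * W * Wᴴ = M * V * Vᴴ := by
      ext a b
      rw [mul_apply, mul_apply, ← Fintype.sum_subtype_add_sum_subtype (fun i => h i ≠ 0),
        Finset.sum_eq_zero (s := (Finset.univ : Finset {i // ¬ h i ≠ 0})), add_zero,
        ← e.sum_comp]
      · rfl
      · intro i _
        have : (M * V) a i = 0 := congrFun (hM i (not_not.1 i.2)) a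
        rw [this, zero_mul]
    rw [h1, Matrix.mul_assoc, hV2, Matrix.mul_one]
  have hfull : ∀ M : Matrix (Fin n) (Fin n) ℂ, M.IsHermitian →
      (∀ i, h i = 0 → M *ᵥ V.col i = 0) → W * (Wᴴ * M * W) * Wᴴ = M := by
    intro M hMh hM
    have h1 := hproj M hM
    have h2 := congrArg conjTranspose h1
    rw [conjTranspose_mul, conjTranspose_mul, conjTranspose_conjTranspose, hMh.eq] at h2
    calc W * (Wᴴ * M * W) * Wᴴ = (W * (Wᴴ * M)) * W * Wᴴ := by simp only [Matrix.mul_assoc]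
      _ = M := by rw [h2, h1]
  have hWC := hfull C hC.isHermitian fun i hi =>
    (mulVec_eq_zero_of_add_conjTranspose_mul_self hC (hker i hi)).1
  have hWB := hfull B hB fun i hi =>
    (mulVec_eq_zero_of_add_conjTranspose_mul_self hC (hker i hi)).2
  refine ⟨_, W, hW1, hWC, hWB, fun hdet => ?_⟩
  obtain ⟨x, hx0, hx⟩ := exists_mulVec_eq_zero_iff.2 hdet
  have hC' := hC.conjTranspose_mul_mul_same W
  have hB' : (Wᴴ * B * W).IsHermitian := isHermitian_conjTranspose_mul_mul W hB
  set C' := Wᴴ * C * W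
  set B' := Wᴴ * B * W
  rw [sub_mulVec, sub_eq_zero, smul_mulVec] at hx
  -- `xᴴ C' x = i xᴴ B' x` is both real and imaginary
  have h1 : star x ⬝ᵥ (C' *ᵥ x) = 0 := by
    have h2 : star x ⬝ᵥ (C' *ᵥ x) = Complex.I * (star x ⬝ᵥ (B' *ᵥ x)) := by
      rw [hx, dotProduct_smul, smul_eq_mul]
    have h3 := (Complex.le_def.1 (hC'.dotProduct_mulVec_nonneg x)).2
    have h4 : (star x ⬝ᵥ (B' *ᵥ x)).im = 0 := hB'.im_star_dotProduct_mulVec_self x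
    rw [h2] at h3 ⊢
    have h5 : (star x ⬝ᵥ (B' *ᵥ x)).re = 0 := by simpa using h3.symm
    rw [Complex.ext (z := star x ⬝ᵥ (B' *ᵥ x)) (w := 0) h5 h4, mul_zero]
  have hCx : C' *ᵥ x = 0 := (hC'.dotProduct_mulVec_zero_iff x).1 h1
  have hBx : B' *ᵥ x = 0 := by
    rw [hCx] at hx
    exact (smul_eq_zero.1 hx.symm).resolve_left Complex.I_ne_zero
  have hlift : ∀ (M : Matrix (Fin n) (Fin n) ℂ), W * (Wᴴ * M * W) * Wᴴ = M →
      (Wᴴ * M * W) *ᵥ x = 0 → M *ᵥ (W *ᵥ x) = 0 := by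
    intro M hM hMx
    rw [← hM, mulVec_mulVec, Matrix.mul_assoc _ Wᴴ W, hW1, Matrix.mul_one, ← mulVec_mulVec, hMx,
      mulVec_zero]
  have hHx : (C + Bᴴ * B) *ᵥ (W *ᵥ x) = 0 := by
    rw [add_mulVec, hlift C hWC hCx, ← mulVec_mulVec, hlift B hWB hBx, mulVec_zero, add_zero]
  have hWH : Wᴴ * (C + Bᴴ * B) * W = diagonal fun j => (h (e j) : ℂ) := by
    have : (Vᴴ * (C + Bᴴ * B) * V).submatrix (fun j => (e j : Fin n)) (fun j => (e j : Fin n)) =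
        diagonal fun j => (h (e j) : ℂ) := by
      rw [hV, submatrix_diagonal _ _ hinj]
      rfl
    exact this
  have h6 : (diagonal fun j => (h (e j) : ℂ)) *ᵥ x = 0 := by
    rw [← hWH, ← mulVec_mulVec, ← mulVec_mulVec, hHx, mulVec_zero]
  refine hx0 (funext fun j => ?_)
  have := congrFun h6 j
  rw [mulVec_diagonal] at this
  exact (mul_eq_zero.1 this).resolve_left (Complex.ofReal_ne_zero.2 (e j).2)

/-! ### Algebraic multiplicities -/

theorem sub_smul_eq_of_compression {n r : ℕ} {A B : Matrix (Fin n) (Fin n) ℂ}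
    {A' B' : Matrix (Fin r) (Fin r) ℂ} {W : Matrix (Fin n) (Fin r) ℂ} (hA : W * A' * Wᴴ = A)
    (hB : W * B' * Wᴴ = B) (μ : ℂ) : A - μ • B = W * (A' - μ • B') * Wᴴ := by
  rw [← hA, ← hB, Matrix.mul_sub, Matrix.sub_mul, Matrix.mul_smul, Matrix.smul_mul]

theorem rank_eq_of_compression {n r : ℕ} {M : Matrix (Fin n) (Fin n) ℂ}
    {M' : Matrix (Fin r) (Fin r) ℂ} {W : Matrix (Fin n) (Fin r) ℂ} (hW : Wᴴ * W = 1)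
    (hM : M = W * M' * Wᴴ) (h0 : M'.det ≠ 0) : M.rank = r := by
  apply le_antisymm
  · rw [hM, Matrix.mul_assoc]
    exact (rank_mul_le_left _ _).trans (rank_le_width W)
  · have h1 : M' = Wᴴ * (M * W) := by
      rw [hM]
      calc M' = (Wᴴ * W) * M' * (Wᴴ * W) := by rw [hW, Matrix.one_mul, Matrix.mul_one]
        _ = _ := by simp only [Matrix.mul_assoc]
    calc r = M'.rank := by
          rw [rank_of_isUnit _ ((isUnit_iff_isUnit_det _).2 (isUnit_iff_ne_zero.2 h0)),
            Fintype.card_fin]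
      _ ≤ (M * W).rank := by
          conv_lhs => rw [h1]
          exact rank_mul_le_right _ _
      _ ≤ M.rank := rank_mul_le_left _ _

theorem normalRank_of_compression {n r : ℕ} {A B : Matrix (Fin n) (Fin n) ℂ}
    {A' B' : Matrix (Fin r) (Fin r) ℂ} {W : Matrix (Fin n) (Fin r) ℂ} (hW : Wᴴ * W = 1)
    (hA : W * A' * Wᴴ = A) (hB : W * B' * Wᴴ = B) {μ₀ : ℂ} (h0 : (A' - μ₀ • B').det ≠ 0) :
    normalRank A B = r := by
  have hle : ∀ μ : ℂ, (A - μ • B).rank ≤ r := by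
    intro μ
    rw [sub_smul_eq_of_compression hA hB, Matrix.mul_assoc]
    exact (rank_mul_le_left _ _).trans (rank_le_width W)
  apply le_antisymm (ciSup_le hle)
  rw [← rank_eq_of_compression hW (sub_smul_eq_of_compression hA hB μ₀) h0]
  exact le_ciSup (f := fun μ : ℂ => (A - μ • B).rank)
    ⟨r, by rintro _ ⟨l, rfl⟩; exact hle l⟩ μ₀

/-- The minors of order `r` of `A - X B = W (A' - X B') Wᴴ` are constant multiples of
`det (A' - X B')`, so the latter determines the algebraic multiplicities. -/
theorem algMultiplicity_of_compression {n r : ℕ} {A B : Matrix (Fin n) (Fin n) ℂ}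
    {A' B' : Matrix (Fin r) (Fin r) ℂ} {W : Matrix (Fin n) (Fin r) ℂ} (hW : Wᴴ * W = 1)
    (hA : W * A' * Wᴴ = A) (hB : W * B' * Wᴴ = B) {Q : ℂ[X]} (hQ0 : Q ≠ 0)
    (hQ : ∀ μ, (A' - μ • B').det = Q.eval μ) (μ : ℂ) :
    algMultiplicity A B μ = Q.rootMultiplicity μ := by
  obtain ⟨μ₀, hμ₀⟩ : ∃ μ₀, Q.eval μ₀ ≠ 0 := by
    by_contra! h
    exact hQ0 (Polynomial.funext fun x => by simp [h])
  have hr : normalRank A B = r := normalRank_of_compression hW hA hB (by rwa [hQ])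
  have hminor : ∀ f g : Fin r → Fin n, ∃ k : ℂ, pencilMinor A B f g = Polynomial.C k * Q := by
    intro f g
    refine ⟨(W.submatrix f id).det * (Wᴴ.submatrix id g).det, Polynomial.funext fun x => ?_⟩
    have h1 : (W * (A' - x • B') * Wᴴ).submatrix f g =
        W.submatrix f id * (A' - x • B') * Wᴴ.submatrix id g := rfl
    rw [eval_pencilMinor, sub_smul_eq_of_compression hA hB, h1, det_mul, det_mul, hQ,
      Polynomial.eval_mul, Polynomial.eval_C]
    ring
  have hset : ∀ m ∈ {m : ℕ | ∃ f g : Fin r → Fin n, pencilMinor A B f g ≠ 0 ∧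
      (pencilMinor A B f g).rootMultiplicity μ = m}, m = Q.rootMultiplicity μ := by
    rintro m ⟨f, g, hne, rfl⟩
    obtain ⟨k, hk⟩ := hminor f g
    rw [hk] at hne ⊢
    rw [Polynomial.rootMultiplicity_mul hne, Polynomial.rootMultiplicity_C, zero_add]
  have hrank := rank_eq_of_compression hW (sub_smul_eq_of_compression hA hB μ₀) (by rwa [hQ])
  obtain ⟨f, g, hfg⟩ := exists_submatrix_det_ne_zero _ hrank
  rw [algMultiplicity, hr]
  refine hset _ (Nat.sInf_mem ⟨_, f, g, fun h => hfg ?_, rfl⟩)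
  rw [← eval_pencilMinor, h, Polynomial.eval_zero]

theorem rootMultiplicity_prod_X_sub_C {p : ℕ} (l : Fin p → ℝ) (μ : ℂ) :
    (∏ i, (Polynomial.X - Polynomial.C (l i : ℂ))).rootMultiplicity μ =
      Nat.card {i : Fin p // (l i : ℂ) = μ} := by
  classical
  have h : ∏ i, (Polynomial.X - Polynomial.C (l i : ℂ)) =
      ((Finset.univ.val.map fun i => (l i : ℂ)).map fun a =>
        Polynomial.X - Polynomial.C a).prod := by
    rw [Multiset.map_map]; rfl
  rw [h, ← Polynomial.count_roots, Polynomial.roots_multiset_prod_X_sub_C, Multiset.count_map,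
    Nat.card_eq_fintype_card, Fintype.card_subtype]
  simp only [Finset.card_def, Finset.filter_val, eq_comm]

/-- A factorization of the determinant of the compressed pencil over lists `lp`, `lm` of reals
exhibits these lists as the finite eigenvalues with their multiplicities. -/
theorem card_eq_algMultiplicity_of_compression {n r p q : ℕ} {A B : Matrix (Fin n) (Fin n) ℂ}
    {A' B' : Matrix (Fin r) (Fin r) ℂ} {W : Matrix (Fin n) (Fin r) ℂ} (hW : Wᴴ * W = 1)
    (hA : W * A' * Wᴴ = A) (hB : W * B' * Wᴴ = B) {lp : Fin p → ℝ} {lm : Fin q → ℝ} {κ : ℂ}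
    (hκ : κ ≠ 0) (h : ∀ μ : ℂ, (A' - μ • B').det =
      κ * ((∏ i, ((lp i : ℂ) - μ)) * ∏ i, (μ - (lm i : ℂ)))) (μ : ℂ) :
    Nat.card {i : Fin p // (lp i : ℂ) = μ} + Nat.card {i : Fin q // (lm i : ℂ) = μ} =
      algMultiplicity A B μ := by
  set Pp : ℂ[X] := ∏ i, (Polynomial.X - Polynomial.C (lp i : ℂ))
  set Pm : ℂ[X] := ∏ i, (Polynomial.X - Polynomial.C (lm i : ℂ))
  have hPp : Pp ≠ 0 := Finset.prod_ne_zero_iff.2 fun i _ => Polynomial.X_sub_C_ne_zero _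
  have hPm : Pm ≠ 0 := Finset.prod_ne_zero_iff.2 fun i _ => Polynomial.X_sub_C_ne_zero _
  have hC : Polynomial.C (κ * (-1) ^ p) ≠ 0 := by simp [hκ]
  rw [algMultiplicity_of_compression hW hA hB (Q := Polynomial.C (κ * (-1) ^ p) * (Pp * Pm))
    (mul_ne_zero hC (mul_ne_zero hPp hPm)) ?_ μ,
    Polynomial.rootMultiplicity_mul (mul_ne_zero hC (mul_ne_zero hPp hPm)),
    Polynomial.rootMultiplicity_mul (mul_ne_zero hPp hPm), Polynomial.rootMultiplicity_C, zero_add,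
    rootMultiplicity_prod_X_sub_C, rootMultiplicity_prod_X_sub_C]
  intro x
  have : ∏ i, ((lp i : ℂ) - x) = (-1) ^ p * ∏ i, (x - (lp i : ℂ)) := by
    have h1 : (-1 : ℂ) ^ p = ∏ _i : Fin p, (-1 : ℂ) := by simp
    rw [h1, ← Finset.prod_mul_distrib]
    exact Finset.prod_congr rfl fun i _ => by ring
  rw [h, this]
  simp only [Pp, Pm, Polynomial.eval_mul, Polynomial.eval_C, Polynomial.eval_prod,
    Polynomial.eval_sub, Polynomial.eval_X]
  ring

/-! ### Ordered lists of eigenvalues -/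

theorem count_ofFn {p : ℕ} (l : Fin p → ℝ) (x : ℝ) :
    (List.ofFn l).count x = Nat.card {i : Fin p // (l i : ℂ) = (x : ℂ)} := by
  classical
  rw [← Multiset.coe_count, ← Fin.univ_val_map, Multiset.count_map, Nat.card_eq_fintype_card,
    Fintype.card_subtype]
  simp only [Finset.card_def, Finset.filter_val, eq_comm, Complex.ofReal_inj]

/-- The finite eigenvalues determine their ordered lists: in increasing order, both pairs of lists
form the sorted list with the given multiplicities. -/
theorem IsOrderedFiniteEig.unique {n p q : ℕ} {A B : Matrix (Fin n) (Fin n) ℂ}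
    {lp lp' : Fin p → ℝ} {lm lm' : Fin q → ℝ} (h : IsOrderedFiniteEig A B lp lm)
    (h' : IsOrderedFiniteEig A B lp' lm') : lp = lp' ∧ lm = lm' := by
  have hs : ∀ {lp : Fin p → ℝ} {lm : Fin q → ℝ}, IsOrderedFiniteEig A B lp lm →
      ((List.ofFn lm).reverse ++ List.ofFn lp).Pairwise (· ≤ ·) := by
    intro lp lm h
    rw [List.pairwise_append, List.pairwise_reverse, List.pairwise_ofFn, List.pairwise_ofFn]
    refine ⟨fun i j hij => h.antitone_neg hij.le, fun i j hij => h.monotone_pos hij.le, ?_⟩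
    intro a ha b hb
    obtain ⟨i, rfl⟩ := List.mem_ofFn.1 (List.mem_reverse.1 ha)
    obtain ⟨j, rfl⟩ := List.mem_ofFn.1 hb
    exact h.neg_le_pos i j
  have hc : ∀ {lp : Fin p → ℝ} {lm : Fin q → ℝ}, IsOrderedFiniteEig A B lp lm → ∀ x : ℝ,
      ((List.ofFn lm).reverse ++ List.ofFn lp).count x = algMultiplicity A B x := by
    intro lp lm h x
    rw [List.count_append, List.count_reverse, count_ofFn, count_ofFn, add_comm, h.count_eq]
  have hperm : ((List.ofFn lm).reverse ++ List.ofFn lp).Perm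
      ((List.ofFn lm').reverse ++ List.ofFn lp') :=
    List.perm_iff_count.2 fun x => by rw [hc h, hc h']
  have heq := hperm.eq_of_pairwise' (hs h) (hs h')
  obtain ⟨h1, h2⟩ := List.append_inj heq (by simp)
  exact ⟨List.ofFn_injective h2, List.ofFn_injective (List.reverse_injective h1)⟩

/-- The statement for a positive semidefinite first coefficient `C`, which is the case `λ₀ = 0`;
the eigenvalues of `C + l B` against `B` are those of `C` shifted by `l`. -/
theorem exists_isGLB_traceValues {n : ℕ} {C B : Matrix (Fin n) (Fin n) ℂ}
    (hC : C.PosSemidef) (hB : B.IsHermitian) :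
    ∃ (gp : Fin (numPosEig hB) → ℝ) (gm : Fin (numNegEig hB) → ℝ),
      (∀ l : ℝ, IsOrderedFiniteEig (C + (l : ℂ) • B) B (fun i => l + gp i) fun i => l - gm i) ∧
      ∀ (kp km : ℕ) (hkp : kp ≤ numPosEig hB) (hkm : km ≤ numNegEig hB)
        (ωp : Fin kp → ℝ) (ωm : Fin km → ℝ), Antitone ωp → Antitone ωm → (∀ i, 0 ≤ ωp i) →
        (∀ i, 0 ≤ ωm i) → IsGLB (traceValues C B
          (diagonal fun i => (ωp i : ℂ)) (diagonal fun i => (ωm i : ℂ)))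
          (∑ i, ωp i * gp (Fin.castLE hkp i) + ∑ i, ωm i * gm (Fin.castLE hkm i)) := by
  obtain ⟨r, W, hW, hWC, hWB, hreg⟩ := exists_regular_compression hC hB
  have hB' : (Wᴴ * B * W).IsHermitian := isHermitian_conjTranspose_mul_mul W hB
  have hWB' : Wᴴᴴ * (Wᴴ * B * W) * Wᴴ = B := by rw [conjTranspose_conjTranspose, hWB]
  have hWC' : Wᴴᴴ * (Wᴴ * C * W) * Wᴴ = C := by rw [conjTranspose_conjTranspose, hWC]
  have hp : numPosEig hB' = numPosEig hB := le_antisymm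
    (numPosEig_le_of_congruence hB hB' W rfl) (numPosEig_le_of_congruence hB' hB Wᴴ hWB')
  have hq : numNegEig hB' = numNegEig hB := le_antisymm
    (numNegEig_le_of_congruence hB hB' W rfl) (numNegEig_le_of_congruence hB' hB Wᴴ hWB')
  have key := exists_isGLB_traceValues_of_posSemidef (hC.conjTranspose_mul_mul_same W) hB' hreg
  rw [hp, hq] at key
  obtain ⟨gp, gm, hgp, hgm, hgp0, hgm0, hglb, κ, hκ, hdet⟩ := key
  refine ⟨gp, gm, fun l => ⟨fun i j hij => ?_, fun i j hij => ?_, fun i j => ?_, ?_⟩, ?_⟩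
  · have := hgp hij
    linarith
  · have := hgm hij
    linarith
  · have := hgp0 j
    have := hgm0 i
    linarith
  · refine card_eq_algMultiplicity_of_compression hW
      (A' := Wᴴ * C * W + (l : ℂ) • (Wᴴ * B * W)) (B' := Wᴴ * B * W) ?_ hWB hκ ?_
    · rw [Matrix.mul_add, Matrix.add_mul, Matrix.mul_smul, Matrix.smul_mul, hWC, hWB]
    · intro μ
      have h1 : Wᴴ * C * W + (l : ℂ) • (Wᴴ * B * W) - μ • (Wᴴ * B * W) =
          Wᴴ * C * W - (μ - l) • (Wᴴ * B * W) := by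
        rw [sub_smul]; abel
      rw [h1, hdet]
      congr 2
      · refine Finset.prod_congr rfl fun i _ => ?_
        push_cast; ring
      · refine Finset.prod_congr rfl fun i _ => ?_
        push_cast; ring
  · intro kp km hkp hkm ωp ωm h1 h2 h3 h4
    have h5 : traceValues C B (diagonal fun i => (ωp i : ℂ)) (diagonal fun i => (ωm i : ℂ)) =
        traceValues (Wᴴ * C * W) (Wᴴ * B * W) (diagonal fun i => (ωp i : ℂ))
          (diagonal fun i => (ωm i : ℂ)) := by
      refine subset_antisymm ?_ (traceValues_congruence_subset _ _ _ _ _)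
      have := traceValues_congruence_subset Wᴴ (Wᴴ * C * W) (Wᴴ * B * W)
        (diagonal fun i => (ωp i : ℂ)) (diagonal fun i => (ωm i : ℂ))
      rwa [hWB', hWC'] at this
    rw [h5]
    exact hglb kp km hkp hkm ωp ωm h1 h2 h3 h4

/-! ### Reduction of the weights and of the shift -/

/-- The spectral theorem with the eigenvalues in decreasing order. -/
theorem exists_unitary_decreasingEig {k : ℕ} {D : Matrix (Fin k) (Fin k) ℂ} (hD : D.IsHermitian) :
    ∃ V : Matrix (Fin k) (Fin k) ℂ, Vᴴ * V = 1 ∧ V * Vᴴ = 1 ∧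
      Vᴴ * D * V = diagonal fun i => (decreasingEig hD i : ℂ) := by
  obtain ⟨V, hV1, -, hV⟩ := exists_unitary_diagonal hD
  set σ : Fin k ≃ Fin k := (finCongr (Fintype.card_fin k).symm).trans
    (Fintype.equivOfCardEq (Fintype.card_fin _))
  have h1 : (V.submatrix id σ)ᴴ * V.submatrix id σ = 1 := by
    have : (Vᴴ * V).submatrix σ σ = 1 := by rw [hV1, submatrix_one_equiv]
    exact this
  refine ⟨V.submatrix id σ, h1, mul_eq_one_comm.1 h1, ?_⟩
  have h2 : (Vᴴ * D * V).submatrix σ σ = diagonal fun i => (decreasingEig hD i : ℂ) := by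
    rw [hV, submatrix_diagonal_equiv]
    congr 1
    ext i
    simp [σ, decreasingEig, IsHermitian.eigenvalues]
  exact h2

theorem decreasingEig_antitone {k : ℕ} {D : Matrix (Fin k) (Fin k) ℂ} (hD : D.IsHermitian) :
    Antitone (decreasingEig hD) :=
  fun _ _ hij => hD.eigenvalues₀_antitone hij

theorem decreasingEig_nonneg {k : ℕ} {D : Matrix (Fin k) (Fin k) ℂ} (hD : D.PosSemidef)
    (i : Fin k) : 0 ≤ decreasingEig hD.isHermitian i := by
  have := hD.eigenvalues_nonneg ((Fintype.equivOfCardEq (Fintype.card_fin _))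
    (Fin.cast (Fintype.card_fin k).symm i))
  simpa [decreasingEig, IsHermitian.eigenvalues] using this

theorem traceValues_subset_of_unitary {n p q : ℕ} (A B : Matrix (Fin n) (Fin n) ℂ)
    (Dp Vp : Matrix (Fin p) (Fin p) ℂ) (Dm Vm : Matrix (Fin q) (Fin q) ℂ) (hp : Vpᴴ * Vp = 1)
    (hm : Vmᴴ * Vm = 1) :
    traceValues A B Dp Dm ⊆ traceValues A B (Vpᴴ * Dp * Vp) (Vmᴴ * Dm * Vm) := by
  rintro t ⟨X, hX, ht⟩
  set V : Matrix (Fin p ⊕ Fin q) (Fin p ⊕ Fin q) ℂ := fromBlocks Vp 0 0 Vm with hVdef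
  have hV : Vᴴ * V = 1 := by
    rw [hVdef, fromBlocks_conjTranspose, fromBlocks_multiply]
    simp [hp, hm]
  have e : ∀ M : Matrix (Fin n) (Fin n) ℂ, (X * V)ᴴ * M * (X * V) = Vᴴ * (Xᴴ * M * X) * V := by
    intro M
    simp only [conjTranspose_mul, Matrix.mul_assoc]
  refine ⟨X * V, ?_, ?_⟩
  · rw [e, hX, hVdef, fromBlocks_conjTranspose, signMatrix, fromBlocks_multiply,
      fromBlocks_multiply]
    simp [hp, hm]
  · have h1 : fromBlocks (Vpᴴ * Dp * Vp) 0 0 (Vmᴴ * Dm * Vm) = Vᴴ * fromBlocks Dp 0 0 Dm * V := by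
      rw [hVdef, fromBlocks_conjTranspose, fromBlocks_multiply, fromBlocks_multiply]
      simp
    have hV' : V * Vᴴ = 1 := mul_eq_one_comm.1 hV
    rw [e, h1, ← ht]
    calc (Vᴴ * fromBlocks Dp 0 0 Dm * V * (Vᴴ * (Xᴴ * A * X) * V)).trace
        = (Vᴴ * (fromBlocks Dp 0 0 Dm * (V * Vᴴ) * (Xᴴ * A * X) * V)).trace := by
          simp only [Matrix.mul_assoc]
      _ = (fromBlocks Dp 0 0 Dm * (Xᴴ * A * X)).trace := by
          rw [trace_mul_comm, hV', Matrix.mul_one, Matrix.mul_assoc _ V, hV', Matrix.mul_one]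

theorem traceValues_eq_of_unitary {n p q : ℕ} (A B : Matrix (Fin n) (Fin n) ℂ)
    (Dp Vp : Matrix (Fin p) (Fin p) ℂ) (Dm Vm : Matrix (Fin q) (Fin q) ℂ) (hp : Vpᴴ * Vp = 1)
    (hm : Vmᴴ * Vm = 1) :
    traceValues A B Dp Dm = traceValues A B (Vpᴴ * Dp * Vp) (Vmᴴ * Dm * Vm) := by
  refine subset_antisymm (traceValues_subset_of_unitary A B Dp Vp Dm Vm hp hm) ?_
  have hp' : Vp * Vpᴴ = 1 := mul_eq_one_comm.1 hp
  have hm' : Vm * Vmᴴ = 1 := mul_eq_one_comm.1 hm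
  have h := traceValues_subset_of_unitary A B (Vpᴴ * Dp * Vp) Vpᴴ (Vmᴴ * Dm * Vm) Vmᴴ
    (by rw [conjTranspose_conjTranspose, hp']) (by rw [conjTranspose_conjTranspose, hm'])
  have e : ∀ {m : ℕ} (V D : Matrix (Fin m) (Fin m) ℂ), V * Vᴴ = 1 →
      Vᴴᴴ * (Vᴴ * D * V) * Vᴴ = D := by
    intro m V D hV
    calc Vᴴᴴ * (Vᴴ * D * V) * Vᴴ = (V * Vᴴ) * D * (V * Vᴴ) := by
          simp only [conjTranspose_conjTranspose, Matrix.mul_assoc]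
      _ = D := by rw [hV, Matrix.one_mul, Matrix.mul_one]
  rwa [e Vp Dp hp', e Vm Dm hm'] at h

theorem add_mem_traceValues_add_smul {n kp km : ℕ} {C B : Matrix (Fin n) (Fin n) ℂ}
    {ωp : Fin kp → ℝ} {ωm : Fin km → ℝ} {t : ℝ} (l : ℝ)
    (ht : t ∈ traceValues C B (diagonal fun i => (ωp i : ℂ)) (diagonal fun i => (ωm i : ℂ))) :
    l * (∑ i, ωp i - ∑ i, ωm i) + t ∈ traceValues (C + (l : ℂ) • B) B
      (diagonal fun i => (ωp i : ℂ)) (diagonal fun i => (ωm i : ℂ)) := by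
  obtain ⟨X, hX, ht⟩ := ht
  refine ⟨X, hX, ?_⟩
  have h1 : (fromBlocks (diagonal fun i => (ωp i : ℂ)) 0 0 (diagonal fun i => (ωm i : ℂ)) *
      signMatrix kp km).trace = ∑ i, (ωp i : ℂ) - ∑ i, (ωm i : ℂ) := by
    rw [trace_fromBlocks_diagonal_mul, signMatrix_eq_diagonal]
    simp [sub_eq_add_neg]
  rw [Matrix.mul_add, Matrix.add_mul, Matrix.mul_add, trace_add, ht, Matrix.mul_smul,
    Matrix.smul_mul, Matrix.mul_smul, trace_smul, hX, h1]
  push_cast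
  rw [smul_eq_mul, add_comm]

theorem traceValues_add_smul {n kp km : ℕ} (C B : Matrix (Fin n) (Fin n) ℂ)
    (ωp : Fin kp → ℝ) (ωm : Fin km → ℝ) (l : ℝ) :
    traceValues (C + (l : ℂ) • B) B
      (diagonal fun i => (ωp i : ℂ)) (diagonal fun i => (ωm i : ℂ)) =
    OrderIso.addLeft (l * (∑ i, ωp i - ∑ i, ωm i)) '' traceValues C B
      (diagonal fun i => (ωp i : ℂ)) (diagonal fun i => (ωm i : ℂ)) := by
  apply subset_antisymm
  · intro t ht
    have h := add_mem_traceValues_add_smul (-l) ht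
    have e : C + (l : ℂ) • B + ((-l : ℝ) : ℂ) • B = C := by
      push_cast; rw [neg_smul]; abel
    rw [e] at h
    exact ⟨_, h, by simp⟩
  · rintro _ ⟨t, ht, rfl⟩
    exact add_mem_traceValues_add_smul l ht

theorem exists_real_diagonal_of_isDiag {n : ℕ} {M : Matrix (Fin n) (Fin n) ℂ} (hM : M.IsHermitian)
    (hd : M.IsDiag) : ∃ b : Fin n → ℝ, M = diagonal fun i => (b i : ℂ) :=
  ⟨fun i => (M i i).re, by
    conv_lhs => rw [← hd.diagonal_diag]
    congr 1
    ext i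
    exact (hM.coe_re_apply_self i).symm⟩

/-- The trace minimum of a diagonalizable pencil is attained. -/
theorem exists_isLeast_traceValues_of_isDiagonalizablePencil {n kp km : ℕ}
    {C B : Matrix (Fin n) (Fin n) ℂ} (hC : C.PosSemidef) (hB : B.IsHermitian)
    (h : IsDiagonalizablePencil C B) (hkp : kp ≤ numPosEig hB) (hkm : km ≤ numNegEig hB)
    {ωp : Fin kp → ℝ} {ωm : Fin km → ℝ} (hωp : Antitone ωp) (hωm : Antitone ωm)
    (hωp0 : ∀ i, 0 ≤ ωp i) (hωm0 : ∀ i, 0 ≤ ωm i) :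
    ∃ t, IsLeast (traceValues C B
      (diagonal fun i => (ωp i : ℂ)) (diagonal fun i => (ωm i : ℂ))) t := by
  obtain ⟨U, hU, hUC, hUB⟩ := h
  have hC' := hC.conjTranspose_mul_mul_same U
  obtain ⟨c, hc⟩ := exists_real_diagonal_of_isDiag hC'.isHermitian hUC
  obtain ⟨b, hb⟩ := exists_real_diagonal_of_isDiag (isHermitian_conjTranspose_mul_mul U hB) hUB
  obtain ⟨⟨ep, hep⟩, em, hem⟩ := exists_isSortedRatio_of_congruence hB hU hb c
  rw [hc, posSemidef_diagonal_iff] at hC'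
  rw [traceValues_eq_of_congruence hU hc hb]
  exact ⟨_, isLeast_traceValues_diagonal hep hem (fun i => Complex.zero_le_real.1 (hC' i)) hkp hkm
    ωp hωp hωp0 ωm hωm hωm0⟩

end

end MatrixPencil

theorem mainTheorem5 {n kp km : ℕ} (A B : Matrix (Fin n) (Fin n) ℂ)
    (Dp : Matrix (Fin kp) (Fin kp) ℂ) (Dm : Matrix (Fin km) (Fin km) ℂ)
    (hB : B.IsHermitian) (hAB : MatrixPencil.IsPosSemidefPencil A B)
    (hind : MatrixPencil.GenuinelyIndefinite hB)
    (hDp : Dp.PosSemidef) (hDm : Dm.PosSemidef)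
    (hkp : kp ≤ MatrixPencil.numPosEig hB) (hkm : km ≤ MatrixPencil.numNegEig hB) :
    (∃ (lp : Fin (MatrixPencil.numPosEig hB) → ℝ) (lm : Fin (MatrixPencil.numNegEig hB) → ℝ),
      MatrixPencil.IsOrderedFiniteEig A B lp lm) ∧
    ∀ (lp : Fin (MatrixPencil.numPosEig hB) → ℝ) (lm : Fin (MatrixPencil.numNegEig hB) → ℝ),
      MatrixPencil.IsOrderedFiniteEig A B lp lm →
      IsGLB (MatrixPencil.traceValues A B Dp Dm)
        (∑ i : Fin kp, MatrixPencil.decreasingEig hDp.isHermitian i * lp (Fin.castLE hkp i) -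
          ∑ i : Fin km, MatrixPencil.decreasingEig hDm.isHermitian i * lm (Fin.castLE hkm i)) ∧
      (MatrixPencil.IsDiagonalizablePencil A B →
        (∑ i : Fin kp, MatrixPencil.decreasingEig hDp.isHermitian i * lp (Fin.castLE hkp i) -
          ∑ i : Fin km, MatrixPencil.decreasingEig hDm.isHermitian i * lm (Fin.castLE hkm i)) ∈
          MatrixPencil.traceValues A B Dp Dm) := by
  obtain ⟨hA, -, l₀, hC⟩ := hAB
  obtain ⟨C, hCdef⟩ : ∃ C, C = A - (l₀ : ℂ) • B := ⟨_, rfl⟩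
  rw [← hCdef] at hC
  have hAC : A = C + (l₀ : ℂ) • B := by rw [hCdef, sub_add_cancel]
  obtain ⟨gp, gm, hord, hglb⟩ := MatrixPencil.exists_isGLB_traceValues hC hB
  have hordA := hord l₀
  rw [← hAC] at hordA
  refine ⟨⟨_, _, hordA⟩, fun lp lm h => ?_⟩
  obtain ⟨rfl, rfl⟩ := h.unique hordA
  obtain ⟨Vp, hVp, -, hDp'⟩ := MatrixPencil.exists_unitary_decreasingEig hDp.isHermitian
  obtain ⟨Vm, hVm, -, hDm'⟩ := MatrixPencil.exists_unitary_decreasingEig hDm.isHermitian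
  have hωp := MatrixPencil.decreasingEig_antitone hDp.isHermitian
  have hωm := MatrixPencil.decreasingEig_antitone hDm.isHermitian
  have hωp0 := MatrixPencil.decreasingEig_nonneg hDp
  have hωm0 := MatrixPencil.decreasingEig_nonneg hDm
  set ωp := MatrixPencil.decreasingEig hDp.isHermitian
  set ωm := MatrixPencil.decreasingEig hDm.isHermitian
  have hval : ∑ i, ωp i * (l₀ + gp (Fin.castLE hkp i)) - ∑ i, ωm i * (l₀ - gm (Fin.castLE hkm i)) =
      OrderIso.addLeft (l₀ * (∑ i, ωp i - ∑ i, ωm i))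
        (∑ i, ωp i * gp (Fin.castLE hkp i) + ∑ i, ωm i * gm (Fin.castLE hkm i)) := by
    simp only [OrderIso.addLeft_apply, mul_add, mul_sub, Finset.sum_add_distrib,
      Finset.sum_sub_distrib, ← Finset.sum_mul]
    ring
  have hset : MatrixPencil.traceValues A B Dp Dm =
      OrderIso.addLeft (l₀ * (∑ i, ωp i - ∑ i, ωm i)) '' MatrixPencil.traceValues C B
        (Matrix.diagonal fun i => (ωp i : ℂ)) (Matrix.diagonal fun i => (ωm i : ℂ)) := by
    rw [MatrixPencil.traceValues_eq_of_unitary A B Dp Vp Dm Vm hVp hVm, hDp', hDm', hAC,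
      MatrixPencil.traceValues_add_smul]
  have hC0 := hglb kp km hkp hkm ωp ωm hωp hωm hωp0 hωm0
  beta_reduce
  rw [hval, hset]
  refine ⟨(OrderIso.isGLB_image' _).2 hC0, fun hdiag => Set.mem_image_of_mem _ ?_⟩
  have hdiagC : MatrixPencil.IsDiagonalizablePencil C B := by
    obtain ⟨U, hU, hUA, hUB⟩ := hdiag
    refine ⟨U, hU, ?_, hUB⟩
    rw [hCdef, Matrix.mul_sub, Matrix.sub_mul, Matrix.mul_smul, Matrix.smul_mul]
    exact hUA.sub (hUB.smul _)
  obtain ⟨t, ht⟩ := MatrixPencil.exists_isLeast_traceValues_of_isDiagonalizablePencil hC hB hdiagC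
    hkp hkm hωp hωm hωp0 hωm0
  rw [hC0.unique ht.isGLB]
  exact ht.1
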